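/- Let $d\ge 2$, $n=\lfloor d/2\rfloor$, $\lambda=(\lambda_1,\dots,\lambda_d)\in\mathbb C^d$, $p(x)=\sum_{i=1}^d\lambda_i x^i$, $|\lambda|=\sum_i|\lambda_i|$. For the Liénard system $\dot x=y$, $\dot y=-x+p(x)y$, whose orbits in polar coordinates satisfy $$\frac{dr}{d\theta}=\frac{r\,p(r\cos\theta)\sin^2\theta}{-1+\sin\theta\cos\theta\,p(r\cos\theta)},\qquad(1)$$ let $v_k(\theta)$ be the coefficients of the expansion $r(0)=r+v_2(\theta)r^2+v_3(\theta)r^3+\cdots$ in $r=r(\theta)$; that is, $v_k=0$ for $k\le 0$, $v_1=1$, and for $k\ge2$, $v_k(0)=0$ and $$v_k'(\theta)=\sum_{l=1}^d\lambda_l(\cos\theta)^l\sin\theta\,\bigl[\cos\theta\,v_{k-l}'(\theta)+(k-l)\sin\theta\,v_{k-l}(\theta)\bigr].$$ Put $$f_\lambda(x)=x+\sum_{k\ge2}v_k(2\pi)x^k,\qquad c_{2n+1}=\int_0^{2\pi}(\cos\theta)^{2n}(\sin\theta)^2\,d\theta,\qquad R'=\frac{c_{2n+1}^{\,n}}{2^{10n-1}\,n\,\pi^2\,(1+|\lambda|)^{4n+1}}.$$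 Let $B$ be the Bautin index: the least $K$ such that the ideal of $\mathbb R[\lambda_1,\dots,\lambda_d]$ generated by the polynomials $v_2(2\pi),\dots,v_{K'}(2\pi)$ is the same for all $K'\ge K$. Let $D(0,R')\subset\mathbb C$ be the open disc of radius $R'$ centred at $0$. Theorem. $B=2n+1$, and: (a) The series $f_\lambda$ converges on $D(0,R')$, its sum is analytic there, and it is the (complexified) inverse of the first return map: for $x\in D(0,R')$ and $y\in\mathbb C$, there is a solution $r:[0,2\pi]\to\mathbb C$ of (1), with non-vanishing denominator along it, such that $r(2\pi)=x$ and $r(0)=y$, if and only if $y=f_\lambda(x)$. (b) $f_\lambda$ has fewer than $B-1=2n$ zeros in $D(0,R')$, counted with multiplicity. (c) If $f_\lambda(x)$ is not identically equal to $x$ on $D(0,R')$, then the equation $f_\lambda(x)=x$ (complex limit cycles) has fewer than $B-1=2n$ solutions in $D(0,R')$, where the trivial solution $x=0$ is counted once and the other solutions are counted with multiplicity. If the multiplicity of $x=0$ is counted as well, the number of solutions of $f_\lambda(x)-x=0$ in $D(0,R')$ is at most $B=2n+1$; equivalently, $(f_\lambda(x)-x)/x$ has at most $B-1=2n$ zeros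 in $D(0,R')$ counted with multiplicity. -/

import Mathlib

open scoped BigOperators

noncomputable section

namespace Lienard

/-- `p(z) = ∑_{i=1}^d λ_i z^i`; the parameter `λ_i` is `lam l` with `i = l + 1`. -/
def p {d : ℕ} (lam : Fin d → ℂ) (z : ℂ) : ℂ :=
  ∑ l : Fin d, lam l * z ^ ((l : ℕ) + 1)

/-- `|λ| = |λ_1| + ... + |λ_d|`. -/
def parNorm {d : ℕ} (lam : Fin d → ℂ) : ℝ :=
  ∑ l : Fin d, ‖lam l‖

/-- `r` solves, on `[0, 2π]`, the (complexified) equation of the orbits of `x' = y`,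
`y' = -x + p(x) y` in polar coordinates:
`dr/dθ = r p(r cos θ) sin² θ / (-1 + sin θ cos θ p(r cos θ))`, with a denominator that does
not vanish along `r`. -/
def IsPolarOrbit {d : ℕ} (lam : Fin d → ℂ) (r : ℝ → ℂ) : Prop :=
  ∀ θ ∈ Set.Icc (0 : ℝ) (2 * Real.pi),
    -1 + (Real.sin θ : ℂ) * (Real.cos θ : ℂ) * p lam (r θ * (Real.cos θ : ℂ)) ≠ 0 ∧
    HasDerivWithinAt r
      (r θ * p lam (r θ * (Real.cos θ : ℂ)) * (Real.sin θ : ℂ) ^ 2 /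
        (-1 + (Real.sin θ : ℂ) * (Real.cos θ : ℂ) * p lam (r θ * (Real.cos θ : ℂ))))
      (Set.Icc 0 (2 * Real.pi)) θ

/-- The inverse return relation: the orbit which is at `x` for `θ = 2π` is at `y` for `θ = 0`. -/
def InverseReturn {d : ℕ} (lam : Fin d → ℂ) (x y : ℂ) : Prop :=
  ∃ r : ℝ → ℂ, IsPolarOrbit lam r ∧ r (2 * Real.pi) = x ∧ r 0 = y

/-- The coefficients `v_k(θ)` of the expansion `r(0) = r + v_2(θ) r² + v_3(θ) r³ + ...` in
`r = r(θ)`: `v_1 = 1`, and for `k ≥ 2`, `v_k(0) = 0` and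
`v_k' = ∑_{l=1}^d λ_l (cos θ)^l sin θ [cos θ v_{k-l}' + (k-l) sin θ v_{k-l}]`,
where `v_j = 0` for `j ≤ 0`.
(Here `l` is shifted by one, so that `(k+2) - (l+1) = k + 1 - l`; the truncated difference is `0`
exactly when the true one is `≤ 0`, and `v_0 = 0`.) -/
def v {d : ℕ} (lam : Fin d → ℂ) : ℕ → ℝ → ℂ
  | 0 => fun _ => 0
  | 1 => fun _ => 1
  | k + 2 => fun θ => ∫ t in (0 : ℝ)..θ, ∑ l : Fin d,
      lam l * (Real.cos t : ℂ) ^ ((l : ℕ) + 1) * (Real.sin t : ℂ) *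
        ((Real.cos t : ℂ) * deriv (v lam (k + 1 - (l : ℕ))) t +
          ((k + 1 - (l : ℕ) : ℕ) : ℂ) * (Real.sin t : ℂ) * v lam (k + 1 - (l : ℕ)) t)
  termination_by k => k
  decreasing_by all_goals omega

/-- The terms `v_k(2π) x^k` of the series `x + v_2(2π) x² + v_3(2π) x³ + ...`. -/
def term {d : ℕ} (lam : Fin d → ℂ) (x : ℂ) (k : ℕ) : ℂ :=
  v lam k (2 * Real.pi) * x ^ k

/-- `f_λ(x) = x + ∑_{k ≥ 2} v_k(2π) x^k`. -/
def f {d : ℕ} (lam : Fin d → ℂ) (x : ℂ) : ℂ :=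
  ∑' k : ℕ, term lam x k

/-- The ideal of `ℝ[λ_1, ..., λ_d]` generated by `v_2(2π), ..., v_K(2π)`, seen as polynomials
in the parameters. -/
def bautinIdeal (d K : ℕ) : Ideal (MvPolynomial (Fin d) ℝ) :=
  Ideal.span {P | ∃ k : ℕ, 2 ≤ k ∧ k ≤ K ∧
    ∀ lam : Fin d → ℂ, MvPolynomial.aeval lam P = v lam k (2 * Real.pi)}

/-- The Bautin index: the first `K` from which the increasing sequence of ideals generated by
`v_2(2π), ..., v_K(2π)` is stationary. -/
def bautinIndex (d : ℕ) : ℕ :=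
  sInf {K | ∀ K' : ℕ, K ≤ K' → bautinIdeal d K' = bautinIdeal d K}

/-- `c_{2m+1} = ∫_0^{2π} (cos θ)^{2m} (sin θ)² dθ`, as a function of `m`. -/
def c (m : ℕ) : ℝ :=
  ∫ θ in (0 : ℝ)..(2 * Real.pi), Real.cos θ ^ (2 * m) * Real.sin θ ^ 2

/-- The radius `c_{2n+1}^n / (2^{10n-1} n π² (1+|λ|)^{4n+1})`. -/
def radius {d : ℕ} (n : ℕ) (lam : Fin d → ℂ) : ℝ :=
  c n ^ n /
    (2 ^ (10 * n - 1) * (n : ℝ) * Real.pi ^ 2 * (1 + parNorm lam) ^ (4 * n + 1))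

/-- The number in `ℕ∞` of zeros in `s`, counted with multiplicity, of a function `g` which is
analytic at the points of `s`. -/
def zeroCount (g : ℂ → ℂ) (s : Set ℂ) : ℕ∞ :=
  ⨆ (T : Finset ℂ) (_ : (T : Set ℂ) ⊆ s), ∑ x ∈ T, analyticOrderAt g x

end Lienard

end

/-! If `p` has only odd powers, every `v_k` is a polynomial in sin θ, so v_k(2π) = v_k(0): the
origin is a centre (`v_oddPart_two_pi`). Comparing λ with its odd part (`v_sub_v`) gives v_k(2π) =
Σ_{j=1}^n λ_{2j} W_{j,k}, where the divided difference W_{j,k} vanishes for k ≤ 2j and is the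
positive constant c_{2j+1} for k = 2j+1 (`W_eq_zero`, `W_first`). By this triangular shape the first
K coefficients generate the ideal of the λ_{2j} with 2j+1 ≤ K (`bautinIdeal_eq`), whence B = 2n+1.

Majorants of the W's (`norm_W_le`) turn this into f(x) - x = Σ_j λ_{2j} x^{2j+1} (c_{2j+1} + O(x))
with explicit errors that do not involve the ratios of the λ_{2j}. By pigeonhole
(`exists_dominant`), on some circle of radius at least R' one of these n monomials dominates the
others geometrically. The radius R' is so small that the errors remain harmless on the largest
circle that can occur. A Rouché type bound (`sum_analyticOrderAt_le`) then leaves at most 2n-2 zeros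
for (f(x) - x)/x³; the same bound, with dominant term x, treats f itself.

For the return map, Σ v_k(θ) r^k is a first integral (`IsPolarOrbit.f_eq`); existence of a small
orbit and uniqueness among all orbits give the equivalence. -/

noncomputable section

namespace Lienard

/-! ### The recursion for the return coefficients and its divided differences in the parameters. -/

section Recursion

/-- The coefficient of `lam l` in the recursion, evaluated on a sequence of functions `u`. -/
def src (u : ℕ → ℝ → ℂ) (l k : ℕ) (t : ℝ) : ℂ :=
  (Real.cos t : ℂ) ^ (l + 1) * (Real.sin t : ℂ) *
    ((Real.cos t : ℂ) * deriv (u (k - (l + 1))) t +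
      ((k - (l + 1) : ℕ) : ℂ) * (Real.sin t : ℂ) * u (k - (l + 1)) t)

/-- The right-hand side of the recursion, evaluated on a sequence of functions `u`. -/
def rhs {d : ℕ} (lam : Fin d → ℂ) (u : ℕ → ℝ → ℂ) (k : ℕ) (t : ℝ) : ℂ :=
  ∑ l : Fin d, lam l * src u l k t

/-- The solution, vanishing at `θ = 0`, of the recursion with an additional source `S`. -/
def sol {d : ℕ} (lam : Fin d → ℂ) (S : ℕ → ℝ → ℂ) : ℕ → ℝ → ℂ
  | 0 => fun _ => 0
  | k + 1 => fun θ => ∫ t in (0 : ℝ)..θ, ((∑ l : Fin d,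
      lam l * (Real.cos t : ℂ) ^ ((l : ℕ) + 1) * (Real.sin t : ℂ) *
        ((Real.cos t : ℂ) * deriv (sol lam S (k - (l : ℕ))) t +
          ((k - (l : ℕ) : ℕ) : ℂ) * (Real.sin t : ℂ) * sol lam S (k - (l : ℕ)) t)) + S (k + 1) t)
  termination_by k => k
  decreasing_by all_goals omega

variable {d : ℕ} (lam : Fin d → ℂ)

lemma continuous_src {u : ℕ → ℝ → ℂ} {l k : ℕ} (hu : ∀ j, j + 1 ≤ k → ContDiff ℝ 1 (u j))
    (h0 : u 0 = 0) : Continuous (src u l k) := by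
  have key : ContDiff ℝ 1 (u (k - (l + 1))) := by
    rcases Nat.eq_zero_or_pos k with rfl | hk
    · simp only [zero_tsub, h0]; exact contDiff_const
    · exact hu _ (by omega)
  have h1 := key.continuous
  have h2 := key.continuous_deriv le_rfl
  unfold src
  fun_prop

lemma continuous_rhs {u : ℕ → ℝ → ℂ} {k : ℕ} (hu : ∀ j, j + 1 ≤ k → ContDiff ℝ 1 (u j))
    (h0 : u 0 = 0) : Continuous (rhs lam u k) :=
  continuous_finsetSum _ fun _ _ => continuous_const.mul (continuous_src hu h0)

lemma src_eq_zero {u : ℕ → ℝ → ℂ} (h0 : u 0 = 0) {l k : ℕ} (hk : k ≤ l + 1) :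
    src u l k = 0 := by
  funext t
  have e : k - (l + 1) = 0 := by omega
  simp [src, e, h0]

lemma contDiff_one_of_hasDerivAt {u g : ℝ → ℂ} (hg : Continuous g)
    (h : ∀ t, HasDerivAt u (g t) t) : ContDiff ℝ 1 u := by
  rw [contDiff_one_iff_deriv]
  refine ⟨fun t => (h t).differentiableAt, ?_⟩
  rw [show deriv u = g from funext fun t => (h t).deriv]
  exact hg

lemma v_zero : v lam 0 = 0 := by funext t; rw [v]; rfl

lemma v_one : v lam 1 = fun _ => 1 := by funext t; rw [v]

lemma v_add_two (k : ℕ) (θ : ℝ) :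
    v lam (k + 2) θ = ∫ t in (0 : ℝ)..θ, rhs lam (v lam) (k + 2) t := by
  have e : ∀ l : Fin d, k + 2 - ((l : ℕ) + 1) = k + 1 - (l : ℕ) := fun l => by omega
  rw [v]
  simp only [rhs, src, e, mul_assoc]

lemma rhs_eq_zero_of_le_one {u : ℕ → ℝ → ℂ} (h0 : u 0 = 0) {k : ℕ} (hk : k ≤ 1) : rhs lam u k = 0 := by
  funext t
  exact Finset.sum_eq_zero fun l _ => by simp [src_eq_zero h0 (show k ≤ (l : ℕ) + 1 by omega)]

lemma contDiff_v_and_hasDerivAt (k : ℕ) :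
    ContDiff ℝ 1 (v lam k) ∧ ∀ t, HasDerivAt (v lam k) (rhs lam (v lam) k t) t := by
  induction k using Nat.strong_induction_on with
  | _ k ih =>
    rcases k with _ | _ | k
    · rw [rhs_eq_zero_of_le_one lam (v_zero lam) (by omega), v_zero]
      exact ⟨contDiff_const, fun t => hasDerivAt_const t 0⟩
    · rw [rhs_eq_zero_of_le_one lam (v_zero lam) (by omega), v_one]
      exact ⟨contDiff_const, fun t => hasDerivAt_const t 1⟩
    · have hc : Continuous (rhs lam (v lam) (k + 2)) :=
        continuous_rhs lam (fun j hj => (ih j (by omega)).1) (v_zero lam)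
      have hd : ∀ t, HasDerivAt (v lam (k + 2)) (rhs lam (v lam) (k + 2) t) t := by
        intro t
        rw [show v lam (k + 2) = fun θ => ∫ t in (0 : ℝ)..θ, rhs lam (v lam) (k + 2) t from
          funext (v_add_two lam k)]
        exact intervalIntegral.integral_hasDerivAt_right (hc.intervalIntegrable _ _)
          (hc.stronglyMeasurableAtFilter _ _) hc.continuousAt
      exact ⟨contDiff_one_of_hasDerivAt hc hd, hd⟩

lemma contDiff_v (k : ℕ) : ContDiff ℝ 1 (v lam k) := (contDiff_v_and_hasDerivAt lam k).1

lemma hasDerivAt_v (k : ℕ) (t : ℝ) : HasDerivAt (v lam k) (rhs lam (v lam) k t) t :=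
  (contDiff_v_and_hasDerivAt lam k).2 t

lemma deriv_v (k : ℕ) (t : ℝ) : deriv (v lam k) t = rhs lam (v lam) k t :=
  (hasDerivAt_v lam k t).deriv

lemma v_apply_zero (k : ℕ) : v lam k 0 = if k = 1 then 1 else 0 := by
  rcases k with _ | _ | k
  · simp [v_zero]
  · simp [v_one]
  · simp [v_add_two]

section Sol

variable {S : ℕ → ℝ → ℂ}

lemma sol_zero : sol lam S 0 = 0 := by funext t; rw [sol]; rfl

lemma sol_succ (k : ℕ) (θ : ℝ) : sol lam S (k + 1) θ =
    ∫ t in (0 : ℝ)..θ, (rhs lam (sol lam S) (k + 1) t + S (k + 1) t) := by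
  have e : ∀ l : Fin d, k + 1 - ((l : ℕ) + 1) = k - (l : ℕ) := fun l => by omega
  rw [sol]
  simp only [rhs, src, e, mul_assoc]

lemma sol_apply_zero (k : ℕ) : sol lam S k 0 = 0 := by
  rcases k with _ | k
  · simp [sol_zero]
  · simp [sol_succ]

lemma contDiff_sol_and_hasDerivAt (hS : ∀ k, Continuous (S k)) (h0 : S 0 = 0) (k : ℕ) :
    ContDiff ℝ 1 (sol lam S k) ∧
      ∀ t, HasDerivAt (sol lam S k) (rhs lam (sol lam S) k t + S k t) t := by
  induction k using Nat.strong_induction_on with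
  | _ k ih =>
    rcases k with _ | k
    · rw [rhs_eq_zero_of_le_one lam (sol_zero lam) (by omega), sol_zero, h0]
      refine ⟨contDiff_const, fun t => ?_⟩
      simp
    · have hc : Continuous fun t => rhs lam (sol lam S) (k + 1) t + S (k + 1) t :=
        (continuous_rhs lam (fun j hj => (ih j (by omega)).1) (sol_zero lam)).add (hS _)
      have hd : ∀ t, HasDerivAt (sol lam S (k + 1))
          (rhs lam (sol lam S) (k + 1) t + S (k + 1) t) t := by
        intro t
        rw [funext (sol_succ lam (S := S) k)]
        exact intervalIntegral.integral_hasDerivAt_right (hc.intervalIntegrable _ _)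
          (hc.stronglyMeasurableAtFilter _ _) hc.continuousAt
      exact ⟨contDiff_one_of_hasDerivAt hc hd, hd⟩

end Sol

/-- The divided difference of `v lam k` between `lam` and `lam0` in the direction `l`. -/
def W (lam lam0 : Fin d → ℂ) (l : Fin d) : ℕ → ℝ → ℂ := sol lam (src (v lam0) l)

variable (lam0 : Fin d → ℂ)

lemma contDiff_W (l : Fin d) (k : ℕ) : ContDiff ℝ 1 (W lam lam0 l k) :=
  (contDiff_sol_and_hasDerivAt lam
    (fun _ => continuous_src (fun j _ => contDiff_v lam0 j) (v_zero lam0)) (src_eq_zero (v_zero lam0) (by omega)) k).1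

lemma hasDerivAt_W (l : Fin d) (k : ℕ) (t : ℝ) : HasDerivAt (W lam lam0 l k)
    (rhs lam (W lam lam0 l) k t + src (v lam0) l k t) t :=
  (contDiff_sol_and_hasDerivAt lam
    (fun _ => continuous_src (fun j _ => contDiff_v lam0 j) (v_zero lam0)) (src_eq_zero (v_zero lam0) (by omega)) k).2 t

lemma W_zero (l : Fin d) : W lam lam0 l 0 = 0 := sol_zero lam

lemma W_apply_zero (l : Fin d) (k : ℕ) : W lam lam0 l k 0 = 0 := sol_apply_zero lam k

lemma eq_of_hasDerivAt_eq {f g f' : ℝ → ℂ} (hf : ∀ t, HasDerivAt f (f' t) t)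
    (hg : ∀ t, HasDerivAt g (f' t) t) (h0 : f 0 = g 0) : f = g := by
  funext t
  have h : ∀ t, HasDerivAt (fun t => f t - g t) 0 t := fun t => by
    simpa using (hf t).fun_sub (hg t)
  have := is_const_of_deriv_eq_zero (fun t => (h t).differentiableAt) (fun t => (h t).deriv) t 0
  simpa [h0, sub_eq_zero] using this

/-- The recursion is linear in both λ and the unknowns, so the difference of the two recursions is
the recursion with parameter `lam` for v(lam) - v(lam0), plus the sources (lam l - lam0 l) `src (v
lam0) l`. Solving for each source separately gives the `W`, without any division. -/
lemma v_sub_v (k : ℕ) : (fun t => v lam k t - v lam0 k t) =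
    fun t => ∑ l : Fin d, (lam l - lam0 l) * W lam lam0 l k t := by
  induction k using Nat.strong_induction_on with
  | _ k ih =>
    rcases Nat.eq_zero_or_pos k with rfl | hk
    · simp [v_zero, W_zero]
    refine eq_of_hasDerivAt_eq (f' := fun t => rhs lam (v lam) k t - rhs lam0 (v lam0) k t)
      (fun t => (hasDerivAt_v lam k t).sub (hasDerivAt_v lam0 k t)) (fun t => ?_) ?_
    · have h1 := HasDerivAt.fun_sum (u := Finset.univ) fun l (_ : l ∈ Finset.univ) =>
        (hasDerivAt_W lam lam0 l k t).const_mul (lam l - lam0 l)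
      refine h1.congr_deriv ?_
      have e : ∀ j : Fin d, src (v lam) j k t = src (v lam0) j k t +
          ∑ l : Fin d, (lam l - lam0 l) * src (W lam lam0 l) j k t := fun j => by
        have hj := ih (k - ((j : ℕ) + 1)) (by omega)
        have h0 := congrFun hj t
        have h2 := HasDerivAt.fun_sum (u := Finset.univ) fun l (_ : l ∈ Finset.univ) =>
          (((contDiff_W lam lam0 l (k - ((j : ℕ) + 1))).differentiable one_ne_zero t).hasDerivAt
            ).const_mul (lam l - lam0 l)
        have h3 := ((contDiff_v lam (k - ((j : ℕ) + 1))).differentiable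
            one_ne_zero t).hasDerivAt.fun_sub
          ((contDiff_v lam0 (k - ((j : ℕ) + 1))).differentiable one_ne_zero t).hasDerivAt
        rw [← hj] at h2
        have h4 := h3.unique h2
        rw [sub_eq_iff_eq_add'] at h0 h4
        simp only [src, h0, h4, mul_add, Finset.sum_add_distrib, Finset.mul_sum]
        rw [add_add_add_comm]
        congr 1
        congr 1 <;> exact Finset.sum_congr rfl fun l _ => by ring
      have comm : ∑ l : Fin d, ∑ j : Fin d, (lam l - lam0 l) * (lam j * src (W lam lam0 l) j k t) =
          ∑ j : Fin d, ∑ l : Fin d, lam j * ((lam l - lam0 l) * src (W lam lam0 l) j k t) := by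
        rw [Finset.sum_comm]
        exact Finset.sum_congr rfl fun _ _ => Finset.sum_congr rfl fun _ _ => by ring
      have split : ∑ l : Fin d, (lam l - lam0 l) * src (v lam0) l k t =
          ∑ l : Fin d, lam l * src (v lam0) l k t - ∑ l : Fin d, lam0 l * src (v lam0) l k t := by
        simp only [sub_mul, Finset.sum_sub_distrib]
      simp only [rhs, e, mul_add, Finset.sum_add_distrib, Finset.mul_sum]
      rw [comm, split]
      ring
    · simp only [v_apply_zero, W_apply_zero]; simp

end Recursion

/-! ### Majorants, and the vanishing of the return coefficients for odd `p`. -/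

section Bounds

variable {d : ℕ} (lam lam0 : Fin d → ℂ)

lemma parNorm_nonneg : 0 ≤ parNorm lam := Finset.sum_nonneg fun _ _ => norm_nonneg _

lemma norm_src_le (u : ℕ → ℝ → ℂ) (l k : ℕ) (t : ℝ) : ‖src u l k t‖ ≤
    ‖deriv (u (k - (l + 1))) t‖ + ((k - (l + 1) : ℕ) : ℝ) * ‖u (k - (l + 1)) t‖ := by
  have hc : ‖(Real.cos t : ℂ)‖ ≤ 1 := by
    rw [Complex.norm_real]; exact Real.abs_cos_le_one t
  have hs : ‖(Real.sin t : ℂ)‖ ≤ 1 := by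
    rw [Complex.norm_real]; exact Real.abs_sin_le_one t
  have h1 : ‖(Real.cos t : ℂ) ^ (l + 1) * (Real.sin t : ℂ)‖ ≤ 1 := by
    rw [norm_mul, norm_pow]
    exact mul_le_one₀ (pow_le_one₀ (norm_nonneg _) hc) (norm_nonneg _) hs
  unfold src
  rw [norm_mul]
  refine (mul_le_of_le_one_left (norm_nonneg _) h1).trans ((norm_add_le _ _).trans ?_)
  rw [norm_mul, norm_mul, norm_mul, Complex.norm_natCast]
  refine add_le_add (mul_le_of_le_one_left (norm_nonneg _) hc) ?_
  exact mul_le_mul_of_nonneg_right (mul_le_of_le_one_right (by positivity) hs) (norm_nonneg _)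

lemma norm_rhs_le (u : ℕ → ℝ → ℂ) (k : ℕ) (t : ℝ) {C : ℝ} (hC : ∀ l : ℕ, ‖src u l k t‖ ≤ C) :
    ‖rhs lam u k t‖ ≤ parNorm lam * C := by
  unfold rhs parNorm
  refine (norm_sum_le _ _).trans ?_
  rw [Finset.sum_mul]
  refine Finset.sum_le_sum fun l _ => ?_
  rw [norm_mul]
  exact mul_le_mul_of_nonneg_left (hC l) (norm_nonneg _)

/-- A function whose derivative is dominated by the one of `B` is dominated by `B`. -/
lemma norm_le_of_hasDerivAt_le {u g : ℝ → ℂ} {B B' : ℝ → ℝ} (hu : ∀ t, HasDerivAt u (g t) t)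
    (hB : ∀ t, HasDerivAt B (B' t) t) (h0 : ‖u 0‖ ≤ B 0) (h : ∀ t, 0 ≤ t → ‖g t‖ ≤ B' t) {t : ℝ}
    (ht : 0 ≤ t) : ‖u t‖ ≤ B t :=
  image_norm_le_of_norm_deriv_right_le_deriv_boundary (a := 0) (b := t)
    (fun s _ => (hu s).continuousAt.continuousWithinAt)
    (fun s _ => (hu s).hasDerivWithinAt) h0
    (fun s => (hB s)) (fun s hs => h s hs.1) ⟨ht, le_rfl⟩

lemma hasDerivAt_affine_pow (a b : ℝ) (k : ℕ) (t : ℝ) :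
    HasDerivAt (fun t => (a * t + b) ^ k) (a * k * (a * t + b) ^ (k - 1)) t := by
  have h := (((hasDerivAt_id t).const_mul a).add_const b).fun_pow k
  refine h.congr_deriv ?_
  simp only [id]
  ring

/-- The majorant of the functions `v_k`. -/
def X (lam : Fin d → ℂ) (t : ℝ) : ℝ := 2 * (1 + parNorm lam) * t + 2 * (1 + parNorm lam)

lemma le_X {t : ℝ} (ht : 0 ≤ t) : 2 * (1 + parNorm lam) ≤ X lam t := by
  have := parNorm_nonneg lam
  unfold X
  have : 0 ≤ 2 * (1 + parNorm lam) * t := by positivity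
  linarith

lemma one_le_X {t : ℝ} (ht : 0 ≤ t) : 1 ≤ X lam t := by
  have := parNorm_nonneg lam
  linarith [le_X lam ht]

/-- The majorant X^k has derivative 2(1+|λ|) k X^(k-1). Since 2(1+|λ|) ≤ X, the derivative bound at
a lower index j is at most j X^j; with the term (j+1) X^j it stays below 2k X^(k-1), and the factor
|λ| coming from the sum over `l` is absorbed by the slope of X. -/
lemma norm_v_le_aux (k : ℕ) :
    (∀ t, 0 ≤ t → ‖rhs lam (v lam) (k + 1) t‖ ≤
      2 * (1 + parNorm lam) * k * X lam t ^ (k - 1)) ∧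
    ∀ t, 0 ≤ t → ‖v lam (k + 1) t‖ ≤ X lam t ^ k := by
  have hL := parNorm_nonneg lam
  induction k using Nat.strong_induction_on with
  | _ k ih =>
    have h1 : ∀ t, 0 ≤ t → ‖rhs lam (v lam) (k + 1) t‖ ≤
        2 * (1 + parNorm lam) * k * X lam t ^ (k - 1) := by
      intro t ht
      have hX := le_X lam ht
      have hX1 := one_le_X lam ht
      have hs : ∀ l : ℕ, ‖src (v lam) l (k + 1) t‖ ≤ 2 * (k * X lam t ^ (k - 1)) := by
        intro l
        by_cases hl : k + 1 ≤ l + 1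
        · rw [src_eq_zero (v_zero lam) hl]; simp only [Pi.zero_apply, norm_zero]; positivity
        obtain ⟨j, rfl⟩ : ∃ j, k = l + 1 + j := ⟨k - (l + 1), by omega⟩
        obtain ⟨hj1, hj2⟩ := ih j (by omega)
        refine (norm_src_le _ _ _ _).trans ?_
        rw [show l + 1 + j + 1 - (l + 1) = j + 1 by omega, deriv_v]
        have e1 : 2 * (1 + parNorm lam) * j * X lam t ^ (j - 1) ≤ j * X lam t ^ j := by
          rcases Nat.eq_zero_or_pos j with rfl | hj
          · simp
          · conv_rhs => rw [← Nat.sub_add_cancel hj, pow_succ]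
            rw [Nat.sub_add_cancel hj]
            have : 0 ≤ (j : ℝ) * X lam t ^ (j - 1) := by positivity
            nlinarith
        have e2 : X lam t ^ j ≤ X lam t ^ (l + 1 + j - 1) := pow_le_pow_right₀ hX1 (by omega)
        have e3 := (hj1 t ht).trans e1
        have e4 := hj2 t ht
        have e5 : 0 ≤ X lam t ^ j := by positivity
        calc ‖rhs lam (v lam) (j + 1) t‖ + ((j + 1 : ℕ) : ℝ) * ‖v lam (j + 1) t‖
            ≤ j * X lam t ^ j + ((j + 1 : ℕ) : ℝ) * X lam t ^ j := by gcongr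
          _ ≤ 2 * (((l + 1 + j : ℕ) : ℝ) * X lam t ^ j) := by
              push_cast
              have : 0 ≤ (l : ℝ) * X lam t ^ j := by positivity
              nlinarith
          _ ≤ _ := by gcongr
      refine (norm_rhs_le lam _ _ _ hs).trans ?_
      have : 0 ≤ k * X lam t ^ (k - 1) := by positivity
      nlinarith
    refine ⟨h1, fun t ht => ?_⟩
    refine norm_le_of_hasDerivAt_le (fun t => hasDerivAt_v lam (k + 1) t)
      (hasDerivAt_affine_pow (2 * (1 + parNorm lam)) (2 * (1 + parNorm lam)) k) ?_ h1 ht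
    rw [v_apply_zero]
    rcases Nat.eq_zero_or_pos k with rfl | hk
    · simp
    · rw [if_neg (by omega), norm_zero]; positivity

lemma norm_v_le (k : ℕ) {t : ℝ} (ht : 0 ≤ t) : ‖v lam (k + 1) t‖ ≤ X lam t ^ k :=
  (norm_v_le_aux lam k).2 t ht

lemma norm_rhs_v_le (k : ℕ) {t : ℝ} (ht : 0 ≤ t) :
    ‖rhs lam (v lam) (k + 1) t‖ ≤ k * X lam t ^ k := by
  refine ((norm_v_le_aux lam k).1 t ht).trans ?_
  have hX := le_X lam ht
  have hX1 := one_le_X lam ht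
  rcases Nat.eq_zero_or_pos k with rfl | hj
  · simp
  · conv_rhs => rw [← Nat.sub_add_cancel hj, pow_succ]
    rw [Nat.sub_add_cancel hj]
    have : 0 ≤ (k : ℝ) * X lam t ^ (k - 1) := by positivity
    nlinarith

/-- The parameter of index `l` enters the recursion only through v_(k-l-1), which is 0 for k ≤ l+1,
so nothing drives W at these orders. -/
lemma W_eq_zero (l : Fin d) {k : ℕ} (hk : k ≤ (l : ℕ) + 1) : W lam lam0 l k = 0 := by
  induction k using Nat.strong_induction_on with
  | _ k ih =>
    rcases Nat.eq_zero_or_pos k with rfl | h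
    · exact W_zero lam lam0 l
    refine eq_of_hasDerivAt_eq (hasDerivAt_W lam lam0 l k) (fun t => ?_) (W_apply_zero lam lam0 l k)
    rw [src_eq_zero (v_zero lam0) hk]
    have : rhs lam (W lam lam0 l) k t = 0 := by
      refine Finset.sum_eq_zero fun j _ => ?_
      have := ih (k - ((j : ℕ) + 1)) (by omega) (by omega)
      simp [src, this]
    rw [this]
    simp

lemma rhs_W_eq_zero (l : Fin d) {k : ℕ} (hk : k ≤ (l : ℕ) + 2) : rhs lam (W lam lam0 l) k = 0 := by
  funext t
  refine Finset.sum_eq_zero fun j _ => ?_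
  simp [src, W_eq_zero lam lam0 l (k := k - ((j : ℕ) + 1)) (by omega)]

/-- At order l+2 only the source survives, with v_1 = 1, and its integrand is cos^(l+1) sin². It
does not depend on the parameters, and l+1 is even. -/
lemma W_first (l : Fin d) (hl : (l : ℕ) % 2 = 1) :
    W lam lam0 l ((l : ℕ) + 2) (2 * Real.pi) = (c (((l : ℕ) + 1) / 2) : ℂ) := by
  have e : ∀ t, src (v lam0) l ((l : ℕ) + 2) t =
      ((Real.cos t ^ (2 * (((l : ℕ) + 1) / 2)) * Real.sin t ^ 2 : ℝ) : ℂ) := by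
    intro t
    rw [show 2 * (((l : ℕ) + 1) / 2) = (l : ℕ) + 1 by omega]
    simp only [src, show (l : ℕ) + 2 - ((l : ℕ) + 1) = 1 by omega, v_one, deriv_const]
    push_cast
    ring
  have h := intervalIntegral.integral_eq_sub_of_hasDerivAt (a := 0) (b := 2 * Real.pi)
    (fun t _ => hasDerivAt_W lam lam0 l ((l : ℕ) + 2) t) ?_
  · rw [W_apply_zero, sub_zero] at h
    rw [← h, c, ← intervalIntegral.integral_ofReal]
    simp only [rhs_W_eq_zero lam lam0 l le_rfl, e, Pi.zero_apply, zero_add]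
  · refine Continuous.intervalIntegrable ?_ _ _
    exact (continuous_rhs lam (fun j _ => contDiff_W lam lam0 l j) (W_zero lam lam0 l)).add
      (continuous_src (fun j _ => contDiff_v lam0 j) (v_zero lam0))

/-- The majorant of the divided differences. -/
def Z (n : ℕ) (lam : Fin d → ℂ) (t : ℝ) : ℝ :=
  12 * n * (1 + parNorm lam) * t + 4 * (1 + parNorm lam)

lemma X_le_Z {n : ℕ} (hn : 1 ≤ n) (h0 : parNorm lam0 ≤ parNorm lam) {t : ℝ} (ht : 0 ≤ t) :
    X lam0 t ≤ Z n lam t := by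
  have := parNorm_nonneg lam
  have := parNorm_nonneg lam0
  have hn' : (1 : ℝ) ≤ n := by exact_mod_cast hn
  unfold X Z
  have : 2 * (1 + parNorm lam0) ≤ 12 * n * (1 + parNorm lam) := by nlinarith
  gcongr
  linarith

/-- The two bounds form an induction: 4j Z^(j-1) is the derivative of the second majorant. Half of
it pays for the source. The other half pays for the recursion, whose factor k = l+1+i is at most 3ni
because l+2 ≤ 3n; this is why Z has slope 12n(1+|λ|), while Z(0) = 4(1+|λ|) controls the derivative
term. -/
lemma norm_W_le_aux {n : ℕ} (hn : 1 ≤ n) (h0 : parNorm lam0 ≤ parNorm lam) (l : Fin d)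
    (hl : (l : ℕ) + 2 ≤ 3 * n) (j : ℕ) :
    (∀ t, 0 ≤ t → ‖rhs lam (W lam lam0 l) ((l : ℕ) + 1 + j) t +
        src (v lam0) l ((l : ℕ) + 1 + j) t‖ ≤ 4 * j * Z n lam t ^ (j - 1)) ∧
    ∀ t, 0 ≤ t → ‖W lam lam0 l ((l : ℕ) + 1 + j) t‖ ≤
      4 / (12 * n * (1 + parNorm lam)) * Z n lam t ^ j := by
  have hL := parNorm_nonneg lam
  have hn' : (1 : ℝ) ≤ n := by exact_mod_cast hn
  induction j using Nat.strong_induction_on with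
  | _ j ih =>
    have h1 : ∀ t, 0 ≤ t → ‖rhs lam (W lam lam0 l) ((l : ℕ) + 1 + j) t +
        src (v lam0) l ((l : ℕ) + 1 + j) t‖ ≤ 4 * j * Z n lam t ^ (j - 1) := by
      intro t ht
      rcases j with _ | j
      · simp [rhs_W_eq_zero lam lam0 l (show (l : ℕ) + 1 ≤ (l : ℕ) + 2 by omega),
          src_eq_zero (v_zero lam0) (le_refl ((l : ℕ) + 1))]
      have hXZ := X_le_Z lam lam0 hn h0 ht
      have hX1 := one_le_X lam0 ht
      have hZ : 4 * (1 + parNorm lam) ≤ Z n lam t := by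
        unfold Z
        have : 0 ≤ 12 * n * (1 + parNorm lam) * t := by positivity
        linarith
      have hZ1 : 1 ≤ Z n lam t := hX1.trans hXZ
      have hZj : 0 ≤ Z n lam t ^ j := by positivity
      have hsrc : ‖src (v lam0) l ((l : ℕ) + 1 + (j + 1)) t‖ ≤ 2 * (j + 1) * Z n lam t ^ j := by
        refine (norm_src_le _ _ _ _).trans ?_
        rw [show (l : ℕ) + 1 + (j + 1) - ((l : ℕ) + 1) = j + 1 by omega, deriv_v]
        have e1 := norm_rhs_v_le lam0 j ht
        have e2 := norm_v_le lam0 j ht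
        have e3 : X lam0 t ^ j ≤ Z n lam t ^ j := by gcongr
        have e4 : (j : ℝ) * X lam0 t ^ j ≤ j * Z n lam t ^ j := by gcongr
        have e5 : ((j + 1 : ℕ) : ℝ) * ‖v lam0 (j + 1) t‖ ≤ (j + 1) * Z n lam t ^ j := by
          push_cast
          gcongr
          exact e2.trans e3
        nlinarith
      have hrhs : ‖rhs lam (W lam lam0 l) ((l : ℕ) + 1 + (j + 1)) t‖ ≤
          parNorm lam * (4 * (j + 1) * Z n lam t ^ j * (1 / (2 * (1 + parNorm lam)))) := by
        refine norm_rhs_le lam _ _ _ fun q => ?_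
        by_cases hq : j ≤ q
        · have : W lam lam0 l ((l : ℕ) + 1 + (j + 1) - (q + 1)) = 0 :=
            W_eq_zero lam lam0 l (by omega)
          have e : src (W lam lam0 l) q ((l : ℕ) + 1 + (j + 1)) t = 0 := by simp [src, this]
          rw [e, norm_zero]
          positivity
        obtain ⟨i, rfl⟩ : ∃ i, j = q + i + 1 := ⟨j - q - 1, by omega⟩
        obtain ⟨hi1, hi2⟩ := ih (i + 1) (by omega)
        refine (norm_src_le _ _ _ _).trans ?_
        rw [show (l : ℕ) + 1 + (q + i + 1 + 1) - (q + 1) = (l : ℕ) + 1 + (i + 1) by omega,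
          (hasDerivAt_W lam lam0 l _ t).deriv]
        have e1 := hi1 t ht
        have e2 := hi2 t ht
        rw [Nat.add_sub_cancel] at e1
        have p1 : Z n lam t ^ i * (4 * (1 + parNorm lam)) ≤ Z n lam t ^ (q + i + 1) :=
          calc Z n lam t ^ i * (4 * (1 + parNorm lam)) ≤ Z n lam t ^ i * Z n lam t := by gcongr
            _ = Z n lam t ^ (i + 1) := (pow_succ _ _).symm
            _ ≤ _ := pow_le_pow_right₀ hZ1 (by omega)
        have p2 : Z n lam t ^ (i + 1) ≤ Z n lam t ^ (q + i + 1) :=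
          pow_le_pow_right₀ hZ1 (by omega)
        have p3 : (((l : ℕ) + 1 + (i + 1) : ℕ) : ℝ) ≤ 3 * n * (i + 1) := by
          have : (((l : ℕ) + 1 + (i + 1) : ℕ) : ℝ) ≤ ((3 * n * (i + 1) : ℕ) : ℝ) := by
            exact_mod_cast (by nlinarith : (l : ℕ) + 1 + (i + 1) ≤ 3 * n * (i + 1))
          push_cast at this ⊢
          exact this
        have p4 : ((i : ℝ) + 1) ≤ ((q + i + 1 : ℕ) : ℝ) + 1 := by push_cast; linarith
        have q1 : ‖rhs lam (W lam lam0 l) ((l : ℕ) + 1 + (i + 1)) t +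
            src (v lam0) l ((l : ℕ) + 1 + (i + 1)) t‖ ≤
            4 * (((q + i + 1 : ℕ) : ℝ) + 1) * (Z n lam t ^ (q + i + 1) *
              (1 / (4 * (1 + parNorm lam)))) := by
          refine e1.trans ?_
          push_cast at p4 ⊢
          have : Z n lam t ^ i ≤ Z n lam t ^ (q + i + 1) * (1 / (4 * (1 + parNorm lam))) := by
            rw [mul_one_div, le_div_iff₀ (by positivity)]; exact p1
          gcongr
        have q2 : (((l : ℕ) + 1 + (i + 1) : ℕ) : ℝ) * ‖W lam lam0 l ((l : ℕ) + 1 + (i + 1)) t‖ ≤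
            4 * (((q + i + 1 : ℕ) : ℝ) + 1) * (Z n lam t ^ (q + i + 1) *
              (1 / (4 * (1 + parNorm lam)))) := by
          calc (((l : ℕ) + 1 + (i + 1) : ℕ) : ℝ) * ‖W lam lam0 l ((l : ℕ) + 1 + (i + 1)) t‖
              ≤ (3 * n * (((q + i + 1 : ℕ) : ℝ) + 1)) *
                (4 / (12 * n * (1 + parNorm lam)) * Z n lam t ^ (q + i + 1)) := by
                gcongr
                · exact p3.trans (by gcongr)
                · exact e2.trans (by gcongr)
            _ = _ := by field_simp; ring
        refine (add_le_add q1 q2).trans (le_of_eq ?_)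
        field_simp
        ring
      refine (norm_add_le _ _).trans ((add_le_add hrhs hsrc).trans ?_)
      rw [Nat.add_sub_cancel]
      push_cast
      have : parNorm lam * (1 / (2 * (1 + parNorm lam))) ≤ 1 / 2 := by
        rw [mul_one_div, div_le_div_iff₀ (by positivity) (by norm_num)]; linarith
      have h4 : 0 ≤ 4 * ((j : ℝ) + 1) * Z n lam t ^ j := by positivity
      nlinarith
    refine ⟨h1, fun t ht => ?_⟩
    refine norm_le_of_hasDerivAt_le (hasDerivAt_W lam lam0 l _)
      (B := fun t => 4 / (12 * n * (1 + parNorm lam)) * Z n lam t ^ j)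
      (B' := fun t => 4 * j * Z n lam t ^ (j - 1)) (fun t => ?_) ?_ h1 ht
    · refine ((hasDerivAt_affine_pow (12 * n * (1 + parNorm lam)) (4 * (1 + parNorm lam)) j t
        ).const_mul (4 / (12 * n * (1 + parNorm lam)))).congr_deriv ?_
      simp only [Z]
      field_simp
    · rw [W_apply_zero, norm_zero]
      unfold Z
      positivity

/-- Here 80 comes from 24π + 4 ≤ 80, which bounds Z(2π), and 27 from 4·80/12 ≤ 27. -/
lemma norm_W_le {n : ℕ} (hn : 1 ≤ n) (h0 : parNorm lam0 ≤ parNorm lam) (l : Fin d)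
    (hl : (l : ℕ) + 2 ≤ 3 * n) (i : ℕ) :
    ‖W lam lam0 l ((l : ℕ) + 2 + i) (2 * Real.pi)‖ ≤ 27 * (80 * n * (1 + parNorm lam)) ^ i := by
  have hL := parNorm_nonneg lam
  have hn' : (1 : ℝ) ≤ n := by exact_mod_cast hn
  have hpi := Real.pi_lt_d2
  have hpi0 := Real.pi_pos
  have h := (norm_W_le_aux lam lam0 hn h0 l hl (i + 1)).2 (2 * Real.pi) (by positivity)
  rw [show (l : ℕ) + 1 + (i + 1) = (l : ℕ) + 2 + i by omega] at h
  refine h.trans ?_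
  have hZ : Z n lam (2 * Real.pi) ≤ 80 * n * (1 + parNorm lam) := by
    unfold Z
    have : 12 * n * (2 * Real.pi) + 4 ≤ 80 * n := by nlinarith
    nlinarith
  have hZ0 : 0 ≤ Z n lam (2 * Real.pi) := by unfold Z; positivity
  rw [pow_succ, ← mul_assoc, mul_right_comm]
  gcongr
  rw [div_mul_eq_mul_div, div_le_iff₀ (by positivity)]
  linarith

lemma X_two_pi_le : X lam (2 * Real.pi) ≤ 15 * (1 + parNorm lam) := by
  have hL := parNorm_nonneg lam
  have hpi := Real.pi_lt_d2
  unfold X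
  nlinarith

/-- The parameter with the coefficients of even powers removed. -/
def oddPart (lam : Fin d → ℂ) (l : Fin d) : ℂ := if (l : ℕ) % 2 = 0 then lam l else 0

lemma parNorm_oddPart_le : parNorm (oddPart lam) ≤ parNorm lam := by
  refine Finset.sum_le_sum fun l _ => ?_
  unfold oddPart
  split_ifs <;> simp

lemma exists_derivative_eq (Q : Polynomial ℂ) : ∃ P : Polynomial ℂ, P.derivative = Q := by
  induction Q using Polynomial.induction_on' with
  | add p q hp hq =>
    obtain ⟨P, rfl⟩ := hp
    obtain ⟨R, rfl⟩ := hq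
    exact ⟨P + R, Polynomial.derivative_add⟩
  | monomial m a =>
    refine ⟨Polynomial.monomial (m + 1) (a / (m + 1)), ?_⟩
    rw [Polynomial.derivative_monomial, Nat.add_sub_cancel]
    push_cast
    rw [div_mul_cancel₀ _ (Nat.cast_add_one_ne_zero m)]

lemma hasDerivAt_eval_sin (G : Polynomial ℂ) (t : ℝ) :
    HasDerivAt (fun t : ℝ => G.eval (Real.sin t : ℂ))
      (G.derivative.eval (Real.sin t : ℂ) * (Real.cos t : ℂ)) t :=
  HasDerivAt.comp (h₂ := fun z => G.eval z) t (G.hasDerivAt (Real.sin t : ℂ)) (Real.hasDerivAt_sin t).ofReal_comp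

/-- For an odd polynomial `p` the functions `v_k` are polynomials in `sin θ`. -/
lemma v_oddPart_eq_eval_sin (k : ℕ) :
    ∃ G : Polynomial ℂ, ∀ t : ℝ, v (oddPart lam) k t = G.eval (Real.sin t : ℂ) := by
  induction k using Nat.strong_induction_on with
  | _ k ih =>
    rcases Nat.eq_zero_or_pos k with rfl | hk
    · exact ⟨0, fun t => by simp [v_zero]⟩
    have step : ∀ l : Fin d, ∃ Q : Polynomial ℂ, ∀ t : ℝ,
        oddPart lam l * src (v (oddPart lam)) l k t =
          Q.eval (Real.sin t : ℂ) * (Real.cos t : ℂ) := by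
      intro l
      by_cases hl : (l : ℕ) % 2 = 0
      · obtain ⟨G, hG⟩ := ih (k - ((l : ℕ) + 1)) (by omega)
        -- Index `l` even means an odd power cos^(l+1). One factor cos θ is set aside and the rest
        -- is even in cos θ, hence a polynomial in sin θ; the integrand is then the derivative of a
        -- polynomial in sin θ.
        refine ⟨Polynomial.C (lam l) * (1 - Polynomial.X ^ 2) ^ ((l : ℕ) / 2) * Polynomial.X *
          ((1 - Polynomial.X ^ 2) * G.derivative +
            Polynomial.C ((k - ((l : ℕ) + 1) : ℕ) : ℂ) * Polynomial.X * G), fun t => ?_⟩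
        have hder : deriv (v (oddPart lam) (k - ((l : ℕ) + 1))) t =
            G.derivative.eval (Real.sin t : ℂ) * (Real.cos t : ℂ) := by
          rw [funext hG]; exact (hasDerivAt_eval_sin G t).deriv
        have hcs : (Real.cos t : ℂ) ^ 2 = 1 - (Real.sin t : ℂ) ^ 2 := by
          have := Real.sin_sq_add_cos_sq t
          rw [eq_sub_iff_add_eq']
          exact_mod_cast this
        have hpow : (Real.cos t : ℂ) ^ ((l : ℕ) + 1) =
            (1 - (Real.sin t : ℂ) ^ 2) ^ ((l : ℕ) / 2) * (Real.cos t : ℂ) := by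
          rw [← hcs, ← pow_mul, pow_succ]
          congr 2
          omega
        simp only [oddPart, if_pos hl] at hder hG ⊢
        simp only [src, hpow, hder, hG, Polynomial.eval_mul, Polynomial.eval_add,
          Polynomial.eval_sub, Polynomial.eval_pow, Polynomial.eval_C, Polynomial.eval_X,
          Polynomial.eval_one, ← hcs]
        ring
      · exact ⟨0, fun t => by simp [oddPart, hl]⟩
    choose Q hQ using step
    obtain ⟨P, hP⟩ := exists_derivative_eq (∑ l, Q l)
    refine ⟨P + Polynomial.C (v (oddPart lam) k 0 - P.eval 0), fun t => ?_⟩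
    refine congrFun (eq_of_hasDerivAt_eq (g := fun t : ℝ => Polynomial.eval (Real.sin t : ℂ) _)
      (hasDerivAt_v (oddPart lam) k) (fun t => ?_) ?_) t
    · refine (hasDerivAt_eval_sin _ t).congr_deriv ?_
      simp only [Polynomial.derivative_add, Polynomial.derivative_C, add_zero, hP, rhs, hQ,
        Polynomial.eval_finsetSum, Finset.sum_mul]
    · simp

/-- A polynomial in sin θ takes the same value at 0 and at 2π. -/
lemma v_oddPart_two_pi {k : ℕ} (hk : k ≠ 1) : v (oddPart lam) k (2 * Real.pi) = 0 := by
  obtain ⟨G, hG⟩ := v_oddPart_eq_eval_sin lam k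
  have h0 := v_apply_zero (oddPart lam) k
  rw [if_neg hk, hG] at h0
  rw [hG]
  simpa using h0

lemma v_two_pi_eq_sum {k : ℕ} (hk : k ≠ 1) : v lam k (2 * Real.pi) =
    ∑ l : Fin d, (lam l - oddPart lam l) * W lam (oddPart lam) l k (2 * Real.pi) := by
  have h := congrFun (v_sub_v lam (oddPart lam) k) (2 * Real.pi)
  simpa [v_oddPart_two_pi lam hk] using h

end Bounds

/-! ### Polynomial dependence on the parameters, and the Bautin ideal. -/

section Parameters

open MvPolynomial in
/-- Finite sums of products of a real polynomial in the parameters and a smooth real function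
of the angle. -/
inductive IsPolyFun {d : ℕ} : ((Fin d → ℂ) → ℝ → ℂ) → Prop
  | zero : IsPolyFun fun _ _ => 0
  | add_term (F : (Fin d → ℂ) → ℝ → ℂ) (P : MvPolynomial (Fin d) ℝ) (g : ℝ → ℝ)
      (hF : IsPolyFun F) (hg : ContDiff ℝ (⊤ : ℕ∞) g) :
      IsPolyFun fun lam t => F lam t + aeval lam P * (g t : ℂ)

variable {d : ℕ}

namespace IsPolyFun

variable {F G : (Fin d → ℂ) → ℝ → ℂ}

lemma congr (hF : IsPolyFun F) (h : ∀ lam t, G lam t = F lam t) : IsPolyFun G := by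
  rwa [show G = F from funext fun lam => funext fun t => h lam t]

lemma add (hF : IsPolyFun F) (hG : IsPolyFun G) : IsPolyFun fun lam t => F lam t + G lam t := by
  induction hG with
  | zero => simpa using hF
  | add_term G P g _ hg ih =>
    exact (add_term _ P g ih hg).congr fun lam t => (add_assoc _ _ _).symm

lemma sum {ι : Type*} (s : Finset ι) {F : ι → (Fin d → ℂ) → ℝ → ℂ} (h : ∀ i, IsPolyFun (F i)) :
    IsPolyFun fun lam t => ∑ i ∈ s, F i lam t := by
  classical
  induction s using Finset.induction_on with
  | empty => simpa using zero
  | insert i s hi ih => simpa [Finset.sum_insert hi] using (h i).add ih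

lemma term_mul (hF : IsPolyFun F) (P : MvPolynomial (Fin d) ℝ) {g : ℝ → ℝ}
    (hg : ContDiff ℝ (⊤ : ℕ∞) g) :
    IsPolyFun fun lam t => MvPolynomial.aeval lam P * (g t : ℂ) * F lam t := by
  induction hF with
  | zero => simpa using zero
  | add_term F Q h _ hh ih =>
    refine (add_term _ (P * Q) _ ih (hg.mul hh)).congr fun lam t => ?_
    simp only [map_mul]
    push_cast
    ring

lemma mul_left (hF : IsPolyFun F) {g : ℝ → ℝ} (hg : ContDiff ℝ (⊤ : ℕ∞) g) :
    IsPolyFun fun lam t => (g t : ℂ) * F lam t := by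
  simpa using hF.term_mul 1 hg

lemma aeval_mul (hF : IsPolyFun F) (P : MvPolynomial (Fin d) ℝ) :
    IsPolyFun fun lam t => MvPolynomial.aeval lam P * F lam t := by
  simpa using hF.term_mul P (contDiff_const (c := (1 : ℝ)))

lemma one : IsPolyFun fun (_ : Fin d → ℂ) _ => 1 :=
  (add_term _ 1 _ zero (contDiff_const (c := (1 : ℝ)))).congr fun lam t => by simp

lemma exists_hasDerivAt (hF : IsPolyFun F) :
    ∃ G, IsPolyFun G ∧ ∀ lam t, HasDerivAt (F lam) (G lam t) t := by
  induction hF with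
  | zero => exact ⟨_, zero, fun lam t => hasDerivAt_const t 0⟩
  | add_term F P g _ hg ih =>
    obtain ⟨G, hG, h⟩ := ih
    refine ⟨_, add_term G P _ hG (contDiff_infty_iff_deriv.1 hg).2, fun lam t => ?_⟩
    exact (h lam t).fun_add
      (((contDiff_infty_iff_deriv.1 hg).1 t).hasDerivAt.ofReal_comp.const_mul _)

lemma exists_primitive (hF : IsPolyFun F) :
    ∃ G, IsPolyFun G ∧ (∀ lam t, HasDerivAt (G lam) (F lam t) t) ∧ ∀ lam, G lam 0 = 0 := by
  induction hF with
  | zero => exact ⟨_, zero, fun lam t => hasDerivAt_const t 0, fun _ => rfl⟩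
  | add_term F P g _ hg ih =>
    obtain ⟨G, hG, h, h0⟩ := ih
    have hd : ∀ t, HasDerivAt (fun t => ∫ s in (0 : ℝ)..t, g s) (g t) t := fun t =>
      intervalIntegral.integral_hasDerivAt_right (hg.continuous.intervalIntegrable _ _)
        (hg.continuous.stronglyMeasurableAtFilter _ _) hg.continuous.continuousAt
    have hs : ContDiff ℝ (⊤ : ℕ∞) fun t => ∫ s in (0 : ℝ)..t, g s := by
      rw [contDiff_infty_iff_deriv]
      refine ⟨fun t => (hd t).differentiableAt, ?_⟩
      rwa [funext fun t => (hd t).deriv]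
    refine ⟨_, add_term G P _ hG hs, fun lam t => ?_, fun lam => by simp [h0]⟩
    exact (h lam t).fun_add ((hd t).ofReal_comp.const_mul _)

lemma exists_aeval_eq (hF : IsPolyFun F) (t : ℝ) :
    ∃ P : MvPolynomial (Fin d) ℝ, ∀ lam, MvPolynomial.aeval lam P = F lam t := by
  induction hF with
  | zero => exact ⟨0, fun lam => by simp⟩
  | add_term F P g _ hg ih =>
    obtain ⟨Q, hQ⟩ := ih
    exact ⟨Q + P * MvPolynomial.C (g t), fun lam => by simp [hQ]⟩

end IsPolyFun

lemma isPolyFun_src {u : (Fin d → ℂ) → ℕ → ℝ → ℂ} {l k : ℕ}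
    (hu : IsPolyFun fun lam => u lam (k - (l + 1))) : IsPolyFun fun lam => src (u lam) l k := by
  obtain ⟨G, hG, h⟩ := hu.exists_hasDerivAt
  have hc := Real.contDiff_cos (n := (⊤ : ℕ∞))
  have hs := Real.contDiff_sin (n := (⊤ : ℕ∞))
  refine (((hG.mul_left hc).add (hu.mul_left ((contDiff_const
    (c := ((k - (l + 1) : ℕ) : ℝ))).mul hs))).mul_left ((hc.pow (l + 1)).mul hs)).congr
    fun lam t => ?_
  rw [src, (h lam t).deriv]
  push_cast
  ring

/-- The map `M` is the identity or `oddPart`: both are polynomial in the parameters, and W(lam,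
oddPart lam) needs the two together. -/
lemma isPolyFun_rhs {u : (Fin d → ℂ) → ℕ → ℝ → ℂ} {M : (Fin d → ℂ) → Fin d → ℂ}
    {Q : Fin d → MvPolynomial (Fin d) ℝ} (hM : ∀ lam l, M lam l = MvPolynomial.aeval lam (Q l))
    {k : ℕ} (hk : 0 < k) (hu : ∀ j < k, IsPolyFun fun lam => u lam j) :
    IsPolyFun fun lam => rhs (M lam) (u lam) k :=
  (IsPolyFun.sum Finset.univ fun l : Fin d => (isPolyFun_src (l := l) (k := k)
    (hu _ (by omega))).aeval_mul (Q l)).congr fun lam t => by simp only [rhs, hM]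

lemma isPolyFun_v {M : (Fin d → ℂ) → Fin d → ℂ}
    {Q : Fin d → MvPolynomial (Fin d) ℝ} (hM : ∀ lam l, M lam l = MvPolynomial.aeval lam (Q l))
    (k : ℕ) : IsPolyFun fun lam => v (M lam) k := by
  induction k using Nat.strong_induction_on with
  | _ k ih =>
    rcases Nat.eq_zero_or_pos k with rfl | hk
    · exact IsPolyFun.zero.congr fun lam t => by simp [v_zero]
    obtain ⟨G, hG, h, h0⟩ := (isPolyFun_rhs hM hk ih).exists_primitive
    refine (hG.add (IsPolyFun.one.aeval_mul (if k = 1 then 1 else 0))).congr fun lam t => ?_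
    refine congrFun (eq_of_hasDerivAt_eq (g := fun t => G lam t + _)
      (hasDerivAt_v (M lam) k) (fun t => (h lam t).add_const _) ?_) t
    rw [v_apply_zero, h0]
    split_ifs <;> simp

lemma isPolyFun_W {M : (Fin d → ℂ) → Fin d → ℂ}
    {Q : Fin d → MvPolynomial (Fin d) ℝ} (hM : ∀ lam l, M lam l = MvPolynomial.aeval lam (Q l))
    (l : Fin d) (k : ℕ) : IsPolyFun fun lam => W lam (M lam) l k := by
  induction k using Nat.strong_induction_on with
  | _ k ih =>
    rcases Nat.eq_zero_or_pos k with rfl | hk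
    · exact IsPolyFun.zero.congr fun lam t => by simp [W_zero]
    obtain ⟨G, hG, h, h0⟩ := ((isPolyFun_rhs (M := fun lam => lam) (Q := MvPolynomial.X)
      (by simp) hk ih).add (isPolyFun_src (l := l) (k := k)
        (isPolyFun_v hM _))).exists_primitive
    refine hG.congr fun lam t => ?_
    refine congrFun (eq_of_hasDerivAt_eq (hasDerivAt_W lam (M lam) l k) (h lam) ?_) t
    rw [W_apply_zero, h0]

/-- Real points already separate real polynomials, since ℝ is infinite. -/
lemma aeval_injective {P Q : MvPolynomial (Fin d) ℝ}
    (h : ∀ lam : Fin d → ℂ, MvPolynomial.aeval lam P = MvPolynomial.aeval lam Q) : P = Q := by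
  refine MvPolynomial.funext fun x => ?_
  have := h (algebraMap ℝ ℂ ∘ x)
  rw [MvPolynomial.aeval_algebraMap_apply, MvPolynomial.aeval_algebraMap_apply] at this
  simpa [MvPolynomial.aeval_eq_eval] using (algebraMap ℝ ℂ).injective this

lemma c_pos (m : ℕ) : 0 < c m := by
  have hpi := Real.pi_pos
  refine intervalIntegral.integral_pos (by positivity) (by fun_prop)
    (fun x _ => by rw [pow_mul]; positivity) ⟨Real.pi / 4, ⟨by positivity, by linarith⟩, ?_⟩
  rw [Real.cos_pi_div_four, Real.sin_pi_div_four]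
  positivity

lemma c_anti {m m' : ℕ} (h : m ≤ m') : c m' ≤ c m := by
  have hpi := Real.pi_pos
  refine intervalIntegral.integral_mono_on (by positivity)
    (Continuous.intervalIntegrable (by fun_prop) _ _)
    (Continuous.intervalIntegrable (by fun_prop) _ _) fun x _ => ?_
  refine mul_le_mul_of_nonneg_right ?_ (sq_nonneg _)
  rw [pow_mul, pow_mul]
  exact pow_le_pow_of_le_one (sq_nonneg _) (Real.cos_sq_le_one x) h

lemma c_le_four (m : ℕ) : c m ≤ 4 := by
  refine (c_anti (Nat.zero_le m)).trans ?_
  have : c 0 = Real.pi := by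
    simp [c, integral_sin_sq]
  rw [this]
  exact Real.pi_le_four

lemma exists_v_poly (k : ℕ) : ∃ P : MvPolynomial (Fin d) ℝ,
    ∀ lam, MvPolynomial.aeval lam P = v lam k (2 * Real.pi) :=
  (isPolyFun_v (M := fun lam => lam) (Q := MvPolynomial.X) (by simp) k).exists_aeval_eq _

lemma sub_oddPart (lam : Fin d → ℂ) (l : Fin d) :
    lam l - oddPart lam l = if (l : ℕ) % 2 = 1 then lam l else 0 := by
  unfold oddPart
  rcases Nat.mod_two_eq_zero_or_one (l : ℕ) with h | h <;> simp [h]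

lemma exists_W_poly (l : Fin d) (k : ℕ) : ∃ P : MvPolynomial (Fin d) ℝ,
    ∀ lam, MvPolynomial.aeval lam P = W lam (oddPart lam) l k (2 * Real.pi) :=
  (isPolyFun_W (M := oddPart) (Q := fun l => if (l : ℕ) % 2 = 0 then MvPolynomial.X l else 0)
    (fun lam l => by unfold oddPart; split_ifs <;> simp) l k).exists_aeval_eq _

/-- The expansion of the return coefficients over the parameters of even powers. -/
lemma v_poly_eq_sum {P : MvPolynomial (Fin d) ℝ} {k : ℕ} (hk : 2 ≤ k)
    (hP : ∀ lam : Fin d → ℂ, MvPolynomial.aeval lam P = v lam k (2 * Real.pi)) :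
    ∃ w : Fin d → MvPolynomial (Fin d) ℝ,
      (∀ l lam, MvPolynomial.aeval lam (w l) = W lam (oddPart lam) l k (2 * Real.pi)) ∧
      P = ∑ l : Fin d, (if (l : ℕ) % 2 = 1 then MvPolynomial.X l else 0) * w l := by
  choose w hw using fun l : Fin d => exists_W_poly l k
  refine ⟨w, hw, aeval_injective fun lam => ?_⟩
  rw [hP, v_two_pi_eq_sum lam (by omega)]
  simp only [sub_oddPart, map_sum, map_mul, hw]
  refine Finset.sum_congr rfl fun l _ => ?_
  split_ifs <;> simp

/-- The ideal of the parameters `lam l` of even powers with `l + 2 ≤ K`. -/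
def evenIdeal (d K : ℕ) : Ideal (MvPolynomial (Fin d) ℝ) :=
  Ideal.span {P | ∃ l : Fin d, (l : ℕ) % 2 = 1 ∧ (l : ℕ) + 2 ≤ K ∧ P = MvPolynomial.X l}

lemma evenIdeal_mono {K K' : ℕ} (h : K ≤ K') : evenIdeal d K ≤ evenIdeal d K' :=
  Ideal.span_mono fun _ ⟨l, h1, h2, h3⟩ => ⟨l, h1, h2.trans h, h3⟩

lemma term_mem_evenIdeal {K k : ℕ} (hk : k ≤ K) (l : Fin d) {w : MvPolynomial (Fin d) ℝ}
    (hw : ∀ lam, MvPolynomial.aeval lam w = W lam (oddPart lam) l k (2 * Real.pi)) :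
    (if (l : ℕ) % 2 = 1 then MvPolynomial.X l else 0) * w ∈ evenIdeal d K := by
  by_cases h : k ≤ (l : ℕ) + 1
  · have : w = 0 := aeval_injective fun lam => by
      rw [hw, W_eq_zero _ _ _ h]; simp
    simp [this]
  split_ifs with h1
  · exact Ideal.mul_mem_right _ _ (Ideal.subset_span ⟨l, h1, by omega, rfl⟩)
  · simp

/-- The system is triangular: v_(l+2)(2π) is a nonzero constant times the variable `l` plus a
combination of the even-power variables of smaller index, so these variables are recovered one after
the other. -/
lemma bautinIdeal_eq (K : ℕ) : bautinIdeal d K = evenIdeal d K := by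
  refine le_antisymm ?_ ?_
  · refine Ideal.span_le.2 ?_
    rintro P ⟨k, h2, hk, hP⟩
    obtain ⟨w, hw, rfl⟩ := v_poly_eq_sum h2 hP
    exact Ideal.sum_mem _ fun l _ => term_mem_evenIdeal hk l (hw l)
  · suffices h : ∀ m, ∀ l : Fin d, (l : ℕ) = m → (l : ℕ) % 2 = 1 → (l : ℕ) + 2 ≤ K →
        MvPolynomial.X l ∈ bautinIdeal d K by
      refine Ideal.span_le.2 ?_
      rintro P ⟨l, h1, h2, rfl⟩
      exact h _ l rfl h1 h2
    intro m
    induction m using Nat.strong_induction_on with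
    | _ m ih =>
      rintro l rfl hl hK
      obtain ⟨P, hP⟩ := exists_v_poly (d := d) ((l : ℕ) + 2)
      have hPm : P ∈ bautinIdeal d K := Ideal.subset_span ⟨_, by omega, hK, hP⟩
      obtain ⟨w, hw, hPs⟩ := v_poly_eq_sum (by omega) hP
      rw [← Finset.add_sum_erase _ _ (Finset.mem_univ l)] at hPs
      -- At its first order the divided difference is a number, invertible in ℝ.
      have hwl : w l = MvPolynomial.C (c (((l : ℕ) + 1) / 2)) := aeval_injective fun lam => by
        rw [hw, W_first _ _ _ hl]; simp
      have hrest : ∑ j ∈ Finset.univ.erase l,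
          (if (j : ℕ) % 2 = 1 then MvPolynomial.X j else 0) * w j ∈ bautinIdeal d K := by
        refine Ideal.sum_mem _ fun j hj => ?_
        rcases lt_or_ge (j : ℕ) l with hjl | hjl
        · split_ifs with h1
          · exact Ideal.mul_mem_right _ _ (ih j hjl j rfl h1 (by omega))
          · simp
        · have hne : (j : ℕ) ≠ l := fun h => (Finset.mem_erase.1 hj).1 (Fin.ext h)
          have : w j = 0 := aeval_injective fun lam => by
            rw [hw, W_eq_zero _ _ _ (by omega)]; simp
          simp [this]
      have hX : MvPolynomial.X l * MvPolynomial.C (c (((l : ℕ) + 1) / 2)) ∈ bautinIdeal d K := by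
        have := Ideal.sub_mem _ hPm hrest
        rw [hPs, add_sub_cancel_right, if_pos hl, hwl] at this
        exact this
      have := Ideal.mul_mem_right (MvPolynomial.C (c (((l : ℕ) + 1) / 2))⁻¹) _ hX
      rwa [mul_assoc, ← MvPolynomial.C_mul, mul_inv_cancel₀ (c_pos _).ne', MvPolynomial.C_1,
        mul_one] at this

lemma bautinIndex_eq {n : ℕ} (hd : 2 ≤ d) (hn : n = d / 2) : bautinIndex d = 2 * n + 1 := by
  have hmem : ∀ K' : ℕ, 2 * n + 1 ≤ K' → bautinIdeal d K' = bautinIdeal d (2 * n + 1) := by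
    intro K' hK
    rw [bautinIdeal_eq, bautinIdeal_eq]
    refine le_antisymm (Ideal.span_mono ?_) (evenIdeal_mono hK)
    rintro P ⟨l, h1, -, h3⟩
    exact ⟨l, h1, by omega, h3⟩
  refine le_antisymm (Nat.sInf_le hmem) (le_csInf ⟨_, hmem⟩ fun K hK => ?_)
  by_contra! hlt
  have h := hK _ hlt.le
  rw [bautinIdeal_eq, bautinIdeal_eq] at h
  let l0 : Fin d := ⟨2 * n - 1, by omega⟩
  have h0 : MvPolynomial.X l0 ∈ evenIdeal d K := by
    rw [← h]
    exact Ideal.subset_span ⟨l0, by simp only [l0]; omega, by simp only [l0]; omega, rfl⟩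
  -- The last even-power variable is not in the ideal of the earlier ones: at the unit vector of
  -- `l0` they all vanish and it does not.
  have hker : evenIdeal d K ≤ RingHom.ker (MvPolynomial.eval (Pi.single l0 (1 : ℝ))) := by
    refine Ideal.span_le.2 ?_
    rintro P ⟨l, -, h2, rfl⟩
    have : l ≠ l0 := by rintro rfl; simp only [l0] at h2; omega
    simp [RingHom.mem_ker, this]
  have := hker h0
  simp [RingHom.mem_ker] at this

end Parameters

/-! ### Counting zeros by a dominant monomial. -/

section Zeros

lemma exists_eq_pow_mul {u : ℂ → ℂ} {U : Set ℂ} (hU : IsOpen U) (hu : DifferentiableOn ℂ u U)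
    {w : ℂ} (hw : w ∈ U) {k : ℕ} (hk : (k : ℕ∞) ≤ analyticOrderAt u w) :
    ∃ g, DifferentiableOn ℂ g U ∧ ∀ z ∈ U, u z = (z - w) ^ k * g z := by
  classical
  have hua : AnalyticAt ℂ u w := hu.analyticAt (hU.mem_nhds hw)
  obtain ⟨g, hg, hgw⟩ := (natCast_le_analyticOrderAt hua).1 hk
  refine ⟨Function.update (fun z => u z / (z - w) ^ k) w (g w), fun z hz => ?_, fun z hz => ?_⟩
  · by_cases h : z = w
    · subst h
      refine DifferentiableAt.differentiableWithinAt ?_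
      refine hg.differentiableAt.congr_of_eventuallyEq ?_
      filter_upwards [hgw] with y hy
      by_cases hyz : y = z
      · subst hyz; simp
      · rw [Function.update_of_ne hyz, hy, smul_eq_mul]
        exact mul_div_cancel_left₀ _ (pow_ne_zero _ (sub_ne_zero.2 hyz))
    · have h1 : DifferentiableWithinAt ℂ (fun z => u z / (z - w) ^ k) U z :=
        (hu z hz).div (by fun_prop) (pow_ne_zero _ (sub_ne_zero.2 h))
      refine h1.congr_of_eventuallyEq ?_ (Function.update_of_ne h _ _)
      refine Filter.Eventually.filter_mono nhdsWithin_le_nhds ?_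
      filter_upwards [isOpen_ne.mem_nhds h] with y hy
      exact Function.update_of_ne hy _ _
  · by_cases h : z = w
    · subst h
      simpa using hgw.self_of_nhds
    · rw [Function.update_of_ne h, mul_div_cancel₀]
      exact pow_ne_zero _ (sub_ne_zero.2 h)

/-- The exponents are only lower bounds of the orders, so that points of infinite order are allowed.
-/
lemma exists_eq_prod_mul {h : ℂ → ℂ} {U : Set ℂ} (hU : IsOpen U) (hh : DifferentiableOn ℂ h U)
    (T : Finset ℂ) (hT : (T : Set ℂ) ⊆ U) (k : ℂ → ℕ)
    (hk : ∀ z ∈ T, (k z : ℕ∞) ≤ analyticOrderAt h z) :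
    ∃ u, DifferentiableOn ℂ u U ∧ ∀ z ∈ U, h z = (∏ w ∈ T, (z - w) ^ k w) * u z := by
  classical
  induction T using Finset.induction_on with
  | empty => exact ⟨h, hh, by simp⟩
  | insert w T hw ih =>
    obtain ⟨u, hu, hueq⟩ := ih (fun z hz => hT (by simp_all)) fun z hz => hk z (by simp [hz])
    have hwU : w ∈ U := hT (by simp)
    have hq : AnalyticAt ℂ (fun z => ∏ y ∈ T, (z - y) ^ k y) w :=
      Finset.analyticAt_fun_prod _ fun y _ => by fun_prop
    have hq0 : analyticOrderAt (fun z => ∏ y ∈ T, (z - y) ^ k y) w = 0 := by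
      refine hq.analyticOrderAt_eq_zero.2 (Finset.prod_ne_zero_iff.2 fun y hy => ?_)
      exact pow_ne_zero _ (sub_ne_zero.2 fun e => hw (e ▸ hy))
    have hord : analyticOrderAt h w = analyticOrderAt u w := by
      have h1 : h =ᶠ[nhds w] (fun z => ∏ y ∈ T, (z - y) ^ k y) * u := by
        filter_upwards [hU.mem_nhds hwU] with z hz using hueq z hz
      rw [analyticOrderAt_congr h1, analyticOrderAt_mul hq (hu.analyticAt (hU.mem_nhds hwU)), hq0,
        zero_add]
    obtain ⟨g, hg, hgeq⟩ := exists_eq_pow_mul hU hu hwU (k := k w)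
      (hord ▸ hk w (by simp))
    refine ⟨g, hg, fun z hz => ?_⟩
    rw [hueq z hz, hgeq z hz, Finset.prod_insert hw]
    ring

lemma re_pos_of_norm_sub_one_lt {z : ℂ} (h : ‖z - 1‖ < 1) : 0 < z.re := by
  have := (Complex.abs_re_le_norm (z - 1)).trans_lt h
  rw [abs_lt] at this
  simp at this
  linarith

/-- Maximum principle for exp(-F), whose modulus is exp(-Re F) and which is 1 at the centre. -/
lemma exists_mem_sphere_re_nonpos {F : ℂ → ℂ} {r : ℝ} (hr : 0 < r)
    (hF : DifferentiableOn ℂ F (Metric.closedBall 0 r)) (h0 : F 0 = 0) :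
    ∃ z, ‖z‖ = r ∧ (F z).re ≤ 0 := by
  have hne : (Metric.sphere (0 : ℂ) r).Nonempty := NormedSpace.sphere_nonempty.2 hr.le
  have hc : ContinuousOn (fun z => (F z).re) (Metric.sphere 0 r) :=
    Complex.continuous_re.comp_continuousOn
      (hF.continuousOn.mono Metric.sphere_subset_closedBall)
  obtain ⟨z, hz, hmin⟩ := (isCompact_sphere (0 : ℂ) r).exists_isMinOn hne hc
  refine ⟨z, by simpa using hz, ?_⟩
  have hd : DiffContOnCl ℂ (fun z => Complex.exp (-F z)) (Metric.ball 0 r) := by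
    refine DifferentiableOn.diffContOnCl ?_
    rw [closure_ball _ hr.ne']
    exact hF.neg.cexp
  have := Complex.norm_le_of_forall_mem_frontier_norm_le Metric.isBounded_ball hd
    (C := Real.exp (-(F z).re)) (fun y hy => ?_) (subset_closure (Metric.mem_ball_self hr))
  · rw [h0] at this
    simp at this
    linarith
  · rw [frontier_ball _ hr.ne'] at hy
    rw [Complex.norm_exp]
    simpa using hmin hy

/-- If the monomial `a z ^ m` dominates `h` on the circle of radius `r`, then `h` has at most
`m` zeros in the disc of radius `r`. -/
lemma sum_analyticOrderAt_le {h : ℂ → ℂ} {r ρ : ℝ} (hr : 0 < r) (hρ : r < ρ)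
    (hh : DifferentiableOn ℂ h (Metric.ball 0 ρ)) {a : ℂ} {m : ℕ}
    (hdom : ∀ z : ℂ, ‖z‖ = r → ‖h z - a * z ^ m‖ < ‖a * z ^ m‖)
    (T : Finset ℂ) (hT : (T : Set ℂ) ⊆ Metric.ball 0 r) :
    ∑ z ∈ T, analyticOrderAt h z ≤ m := by
  by_contra! hlt
  -- Truncating at m+1 makes the multiplicities finite while their sum still exceeds m.
  set k : ℂ → ℕ := fun z => (min (analyticOrderAt h z) ((m + 1 : ℕ) : ℕ∞)).toNat with hkdef
  have hk : ∀ z, (k z : ℕ∞) = min (analyticOrderAt h z) ((m + 1 : ℕ) : ℕ∞) := fun z =>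
    ENat.natCast_toNat (ne_top_of_le_ne_top (ENat.natCast_ne_top _) (min_le_right _ _))
  set M := ∑ z ∈ T, k z with hM
  have hmM : m + 1 ≤ M := by
    by_cases hbig : ∃ z ∈ T, ((m + 1 : ℕ) : ℕ∞) ≤ analyticOrderAt h z
    · obtain ⟨z, hz, hzm⟩ := hbig
      have : (k z : ℕ∞) = ((m + 1 : ℕ) : ℕ∞) := by rw [hk, min_eq_right hzm]
      have h2 : k z = m + 1 := by exact_mod_cast this
      rw [← h2]
      exact Finset.single_le_sum (fun _ _ => Nat.zero_le _) hz
    · push Not at hbig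
      have : ∑ z ∈ T, analyticOrderAt h z = (M : ℕ∞) := by
        rw [hM, Nat.cast_sum]
        exact Finset.sum_congr rfl fun z hz => by rw [hk, min_eq_left (hbig z hz).le]
      rw [this] at hlt
      exact_mod_cast hlt
  obtain ⟨u, hu, hueq⟩ := exists_eq_prod_mul Metric.isOpen_ball hh T
    (hT.trans (Metric.ball_subset_ball hρ.le)) k fun z _ => by rw [hk]; exact min_le_left _ _
  set q : ℂ → ℂ := fun z => ∏ w ∈ T, (z - w) ^ k w with hq
  -- The reflection of q in the circle: zero-free on the closed disc, and with conj(s) = conj(z)^M q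
  -- when |z| = r, as for Blaschke factors.
  set s : ℂ → ℂ := fun z => ∏ w ∈ T, ((r : ℂ) ^ 2 - (starRingEnd ℂ) w * z) ^ k w with hs
  have hs0 : ∀ z ∈ Metric.closedBall (0 : ℂ) r, s z ≠ 0 := by
    intro z hz
    refine Finset.prod_ne_zero_iff.2 fun w hw => pow_ne_zero _ (sub_ne_zero.2 fun e => ?_)
    have h1 : ‖w‖ < r := by simpa using hT hw
    have h2 : ‖z‖ ≤ r := by simpa using hz
    have h3 := congrArg norm e
    rw [norm_mul, norm_pow, Complex.norm_real, Real.norm_of_nonneg hr.le, RCLike.norm_conj] at h3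
    have := norm_nonneg z
    have := norm_nonneg w
    nlinarith
  have hsd : Differentiable ℂ s := by
    have : ∀ w ∈ T, Differentiable ℂ fun z => ((r : ℂ) ^ 2 - (starRingEnd ℂ) w * z) ^ k w :=
      fun w _ => by fun_prop
    exact Differentiable.fun_finsetProd this
  have ha : a ≠ 0 := by
    rintro rfl
    have := hdom r (by simp [hr.le])
    simp at this
    exact absurd this (not_lt.2 (norm_nonneg _))
  have hballs : Metric.closedBall (0 : ℂ) r ⊆ Metric.ball 0 ρ := Metric.closedBall_subset_ball hρ
  -- This function vanishes at 0 because M > m. On the circle its product with |s|² is r^(2M) h/(a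
  -- z^m), whose real part is positive by dominance: this contradicts the maximum principle above.
  have hF : DifferentiableOn ℂ (fun z => u z * z ^ (M - m) / (a * s z))
      (Metric.closedBall 0 r) := by
    refine DifferentiableOn.div ((hu.mono hballs).mul (by fun_prop))
      (hsd.differentiableOn.const_mul a) fun z hz => mul_ne_zero ha (hs0 z hz)
  obtain ⟨z, hz, hre⟩ := exists_mem_sphere_re_nonpos hr hF
    (by simp [zero_pow (show M - m ≠ 0 by omega)])
  have hz0 : z ≠ 0 := by rintro rfl; simp at hz; exact hr.ne hz
  have hzc : z ∈ Metric.closedBall (0 : ℂ) r := by simp [hz]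
  have hzz : z * (starRingEnd ℂ) z = (r : ℂ) ^ 2 := by
    rw [Complex.mul_conj, Complex.normSq_eq_norm_sq, hz]; push_cast; rfl
  have hconj : (starRingEnd ℂ) (s z) = (starRingEnd ℂ) z ^ M * q z := by
    simp only [hs, hq, map_prod, map_pow, map_sub, map_mul, Complex.conj_conj, Complex.conj_ofReal]
    rw [hM, ← Finset.prod_pow_eq_pow_sum, ← Finset.prod_mul_distrib]
    refine Finset.prod_congr rfl fun w _ => ?_
    rw [← mul_pow, ← hzz]
    ring
  have hE : 0 < (h z / (a * z ^ m)).re := by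
    refine re_pos_of_norm_sub_one_lt ?_
    have h1 := hdom z hz
    have h2 : a * z ^ m ≠ 0 := mul_ne_zero ha (pow_ne_zero _ hz0)
    rw [div_sub_one h2, norm_div, div_lt_one (norm_pos_iff.2 h2)]
    exact h1
  have hrel : u z * z ^ (M - m) / (a * s z) * ((‖s z‖ ^ 2 : ℝ) : ℂ) =
      h z / (a * z ^ m) * (((r ^ 2) ^ M : ℝ) : ℂ) := by
    have h1 : ((‖s z‖ ^ 2 : ℝ) : ℂ) = s z * (starRingEnd ℂ) (s z) := by
      rw [Complex.mul_conj, Complex.normSq_eq_norm_sq]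
    have h2 : z ^ M = z ^ (M - m) * z ^ m := by rw [← pow_add]; congr 1; omega
    have h3 := hs0 z hzc
    rw [h1, hconj, hueq z (hballs hzc)]
    push_cast
    rw [← hzz, mul_pow, h2]
    field_simp
    ring
  have h4 := congrArg Complex.re hrel
  rw [Complex.re_mul_ofReal, Complex.re_mul_ofReal] at h4
  have h5 : 0 < (h z / (a * z ^ m)).re * (r ^ 2) ^ M := by positivity
  have h6 : 0 ≤ ‖s z‖ ^ 2 := by positivity
  nlinarith [mul_nonneg (neg_nonneg.2 hre) h6]

/-- Among finitely many monomials `e_m t ^ m`, one dominates all the others geometrically at one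
of the points `t₀ δ⁻²ʲ`. -/
lemma exists_dominant {n : ℕ} (e : Fin n → ℝ) (he : ∀ m, 0 ≤ e m) (hne : ∃ m, 0 < e m)
    {δ t₀ : ℝ} (hδ : 0 < δ) (hδ1 : δ < 1) (ht : 0 < t₀) :
    ∃ m : Fin n, ∃ j < n, 0 < e m ∧ ∀ i : Fin n,
      e i * (t₀ / δ ^ (2 * j)) ^ (i : ℕ) ≤
        δ ^ ((i : ℕ) - (m : ℕ) + ((m : ℕ) - (i : ℕ))) * (e m * (t₀ / δ ^ (2 * j)) ^ (m : ℕ)) := by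
  obtain ⟨m0, hm0⟩ := hne
  have hn : (Finset.univ : Finset (Fin n)).Nonempty := ⟨m0, Finset.mem_univ _⟩
  set τ : ℕ → ℝ := fun j => t₀ / δ ^ (2 * j) * δ with hτ
  have hτ0 : ∀ j, 0 < τ j := fun j => by positivity
  -- The index of the largest monomial is recorded at the n+1 points τ_j = t₀ δ^(1-2j). Only n
  -- indices exist, so some j < j' share one. For t = t₀ δ^(-2j), maximality at τ_j = tδ controls
  -- the smaller indices and maximality at τ_j' ≥ t/δ the larger ones.
  choose A hA using fun j : Fin (n + 1) =>
    Finset.exists_max_image Finset.univ (fun i : Fin n => e i * τ j ^ (i : ℕ)) hn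
  have hApos : ∀ j, 0 < e (A j) := fun j => by
    have h1 := (hA j).2 m0 (Finset.mem_univ _)
    have h2 : 0 < e m0 * τ j ^ (m0 : ℕ) := by have := hτ0 j; positivity
    exact pos_of_mul_pos_left (h2.trans_le h1) (pow_nonneg (hτ0 j).le _)
  obtain ⟨j, j', hne, hjj⟩ := Fintype.exists_ne_map_eq_of_card_lt A (by simp)
  wlog hlt : j < j' generalizing j j'
  · exact this j' j hne.symm hjj.symm (lt_of_le_of_ne (not_lt.1 hlt) hne.symm)
  refine ⟨A j, j, by have := j'.2; have : (j : ℕ) < j' := hlt; omega, hApos j, fun i => ?_⟩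
  set t := t₀ / δ ^ (2 * (j : ℕ)) with htdef
  have ht0 : 0 < t := by positivity
  rcases le_total (i : ℕ) (A j) with h | h
  · obtain ⟨q, hq⟩ : ∃ q, (A j : ℕ) = i + q := ⟨A j - i, by omega⟩
    have h1 := (hA j).2 i (Finset.mem_univ _)
    simp only [hτ, ← htdef] at h1
    rw [hq, show (i : ℕ) - (i + q) + (i + q - i) = q by omega]
    rw [hq, mul_pow, mul_pow, pow_add δ] at h1
    have h2 : 0 < δ ^ (i : ℕ) := by positivity
    refine le_of_mul_le_mul_right ?_ h2
    linarith
  · obtain ⟨q, hq⟩ : ∃ q, (i : ℕ) = A j + q := ⟨i - A j, by omega⟩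
    have h1 := (hA j').2 i (Finset.mem_univ _)
    rw [← hjj] at h1
    have h3 : t / δ ≤ τ j' := by
      have h4 : t * δ ^ (2 * (j : ℕ)) = t₀ := by rw [htdef]; field_simp
      rw [hτ]
      simp only
      rw [← h4, div_le_iff₀ hδ, div_mul_eq_mul_div, div_mul_eq_mul_div, le_div_iff₀ (by positivity)]
      have h5 : (j : ℕ) + 1 ≤ j' := hlt
      have h6 : δ ^ (2 * (j' : ℕ)) ≤ δ ^ (2 * ((j : ℕ) + 1)) :=
        pow_le_pow_of_le_one hδ.le hδ1.le (by omega)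
      have h7 : δ ^ (2 * ((j : ℕ) + 1)) = δ ^ (2 * (j : ℕ)) * δ * δ := by ring
      rw [h7] at h6
      nlinarith
    have h8 : (t / δ) ^ q ≤ τ j' ^ q := by gcongr
    rw [hq, show (A j : ℕ) + q - A j + (A j - (A j + q)) = q by omega]
    rw [hq] at h1
    rw [pow_add] at h1 ⊢
    have h9 : e i * τ j' ^ q ≤ e (A j) := by
      have : 0 < τ j' ^ (A j : ℕ) := pow_pos (hτ0 _) _
      refine le_of_mul_le_mul_right ?_ this
      linarith
    have h10 : e i * (t / δ) ^ q ≤ e (A j) :=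
      (mul_le_mul_of_nonneg_left h8 (he i)).trans h9
    rw [div_pow, mul_div_assoc', div_le_iff₀ (by positivity)] at h10
    have : 0 ≤ t ^ (A j : ℕ) := by positivity
    nlinarith [mul_le_mul_of_nonneg_right h10 this]

/-- With truncated subtraction the exponent is |i - m|; each side of `m` contributes at most a
geometric series. -/
lemma sum_pow_dist_le {n : ℕ} (m : Fin n) {δ : ℝ} (hδ : 0 ≤ δ) (hδ1 : δ < 1) :
    ∑ i ∈ Finset.univ.erase m, δ ^ ((i : ℕ) - (m : ℕ) + ((m : ℕ) - (i : ℕ))) ≤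
      2 * (δ / (1 - δ)) := by
  have geo : ∀ k, ∑ i ∈ Finset.range k, δ ^ (i + 1) ≤ δ / (1 - δ) := by
    intro k
    have h1 := (summable_geometric_of_lt_one hδ hδ1).sum_le_tsum (Finset.range k)
      (fun i _ => by positivity)
    rw [tsum_geometric_of_lt_one hδ hδ1] at h1
    simp only [pow_succ, ← Finset.sum_mul]
    rw [div_eq_inv_mul]
    exact mul_le_mul_of_nonneg_right h1 hδ
  obtain ⟨k, hk⟩ : ∃ k, n = m + 1 + k := ⟨n - (m + 1), by have := m.2; omega⟩
  have h1 := Finset.add_sum_erase Finset.univ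
    (fun i : Fin n => δ ^ ((i : ℕ) - (m : ℕ) + ((m : ℕ) - (i : ℕ)))) (Finset.mem_univ m)
  rw [Fin.sum_univ_eq_sum_range (fun i => δ ^ (i - (m : ℕ) + ((m : ℕ) - i))) n] at h1
  have hr : ∑ i ∈ Finset.range n, δ ^ (i - (m : ℕ) + ((m : ℕ) - i)) =
      ∑ i ∈ Finset.range m, δ ^ (i + 1) + 1 + ∑ i ∈ Finset.range k, δ ^ (i + 1) := by
    rw [show Finset.range n = Finset.range ((m : ℕ) + 1 + k) from congrArg _ hk,
      Finset.sum_range_add, Finset.sum_range_succ, ← Finset.sum_range_reflect]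
    congr 1
    · congr 1
      · refine Finset.sum_congr rfl fun i hi => ?_
        have := Finset.mem_range.1 hi
        congr 1
        omega
      · simp
    · refine Finset.sum_congr rfl fun i hi => ?_
      congr 1
      omega
  have := geo m
  have := geo k
  simp only [le_refl, tsub_eq_zero_of_le, add_zero, pow_zero] at h1
  linarith

end Zeros

/-! ### Orbits in polar coordinates and the first integral. -/

section Orbits

variable {d : ℕ} (lam : Fin d → ℂ)

lemma summable_nat_mul_pow {q : ℝ} (h0 : 0 ≤ q) (h1 : q < 1) :
    Summable fun k : ℕ => (k : ℝ) * q ^ k := by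
  simpa using summable_pow_mul_geometric_of_norm_lt_one 1 (by rwa [Real.norm_of_nonneg h0])

lemma X_nonneg {t : ℝ} (ht : 0 ≤ t) : 0 ≤ X lam t := zero_le_one.trans (one_le_X lam ht)

lemma norm_v_mul_pow_le (k : ℕ) {t : ℝ} (ht : 0 ≤ t) {z : ℂ} {q : ℝ} (hq : X lam t * ‖z‖ ≤ q) :
    ‖v lam k t * z ^ k‖ ≤ q ^ k := by
  have hX := X_nonneg lam ht
  have h : ‖v lam k t‖ ≤ X lam t ^ k := by
    rcases k with _ | k
    · simp [v_zero]
    · exact (norm_v_le lam k ht).trans (pow_le_pow_right₀ (one_le_X lam ht) (by omega))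
  rw [norm_mul, norm_pow]
  calc ‖v lam k t‖ * ‖z‖ ^ k ≤ X lam t ^ k * ‖z‖ ^ k := by gcongr
    _ = (X lam t * ‖z‖) ^ k := (mul_pow _ _ _).symm
    _ ≤ q ^ k := by gcongr

lemma norm_rhs_mul_pow_le (k : ℕ) {t : ℝ} (ht : 0 ≤ t) {z : ℂ} {q : ℝ}
    (hq : X lam t * ‖z‖ ≤ q) : ‖rhs lam (v lam) k t * z ^ k‖ ≤ k * q ^ k := by
  have hX := X_nonneg lam ht
  have h : ‖rhs lam (v lam) k t‖ ≤ k * X lam t ^ k := by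
    rcases k with _ | k
    · simp [rhs_eq_zero_of_le_one lam (v_zero lam) (zero_le_one)]
    · refine (norm_rhs_v_le lam k ht).trans ?_
      have := pow_le_pow_right₀ (one_le_X lam ht) (show k ≤ k + 1 by omega)
      push_cast
      gcongr
      linarith
  rw [norm_mul, norm_pow]
  calc ‖rhs lam (v lam) k t‖ * ‖z‖ ^ k ≤ k * X lam t ^ k * ‖z‖ ^ k := by gcongr
    _ = k * (X lam t * ‖z‖) ^ k := by rw [mul_pow, mul_assoc]
    _ ≤ k * q ^ k := by gcongr

/-- Subtraction is truncated, so the terms with k < m are all `y 0`, which has to be 0. -/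
lemma hasSum_shift {y : ℕ → ℂ} {Y : ℂ} (h : HasSum y Y) (h0 : y 0 = 0) (m : ℕ) :
    HasSum (fun k => y (k - m)) Y := by
  rw [← hasSum_nat_add_iff' m]
  have : ∑ i ∈ Finset.range m, y (i - m) = 0 := Finset.sum_eq_zero fun i hi => by
    rw [Nat.sub_eq_zero_of_le (Finset.mem_range.1 hi).le, h0]
  simpa [this] using h

/-- The partial differential equation satisfied by the generating function of the `v_k`. -/
lemma tsum_rhs_eq {t : ℝ} (ht : 0 ≤ t) {z : ℂ} (hz : X lam t * ‖z‖ < 1) :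
    ∑' k, rhs lam (v lam) k t * z ^ k =
      p lam (z * (Real.cos t : ℂ)) * (Real.sin t : ℂ) *
        ((Real.cos t : ℂ) * ∑' k, rhs lam (v lam) k t * z ^ k +
          (Real.sin t : ℂ) * ∑' k : ℕ, (k : ℂ) * (v lam k t * z ^ k)) := by
  have hq0 : 0 ≤ X lam t * ‖z‖ := mul_nonneg (X_nonneg lam ht) (norm_nonneg _)
  have hs := summable_nat_mul_pow hq0 hz
  have hA : Summable fun k => rhs lam (v lam) k t * z ^ k :=
    Summable.of_norm_bounded hs fun k => norm_rhs_mul_pow_le lam k ht le_rfl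
  have hB : Summable fun k : ℕ => (k : ℂ) * (v lam k t * z ^ k) :=
    Summable.of_norm_bounded hs fun k => by
      rw [norm_mul, Complex.norm_natCast]
      exact mul_le_mul_of_nonneg_left (norm_v_mul_pow_le lam k ht le_rfl) (Nat.cast_nonneg _)
  have hY := (hA.hasSum.mul_left (Real.cos t : ℂ)).add (hB.hasSum.mul_left (Real.sin t : ℂ))
  have hsum := hasSum_sum (s := Finset.univ) fun (l : Fin d) _ =>
    (hasSum_shift hY (by simp [rhs_eq_zero_of_le_one lam (v_zero lam) zero_le_one]) ((l : ℕ) + 1)).mul_left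
      (lam l * (Real.cos t : ℂ) ^ ((l : ℕ) + 1) * (Real.sin t : ℂ) * z ^ ((l : ℕ) + 1))
  rw [← Finset.sum_mul] at hsum
  have hp : p lam (z * (Real.cos t : ℂ)) * (Real.sin t : ℂ) = ∑ l : Fin d,
      lam l * (Real.cos t : ℂ) ^ ((l : ℕ) + 1) * (Real.sin t : ℂ) * z ^ ((l : ℕ) + 1) := by
    unfold p
    rw [Finset.sum_mul]
    exact Finset.sum_congr rfl fun l _ => by rw [mul_pow]; ring
  rw [← hp] at hsum
  refine HasSum.tsum_eq (hsum.congr_fun fun k => ?_)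
  rw [rhs, Finset.sum_mul]
  refine Finset.sum_congr rfl fun l _ => ?_
  rw [src, deriv_v]
  rcases le_or_gt ((l : ℕ) + 1) k with h | h
  · obtain ⟨j, rfl⟩ : ∃ j, k = (l : ℕ) + 1 + j := ⟨k - (l + 1), by omega⟩
    rw [show (l : ℕ) + 1 + j - ((l : ℕ) + 1) = j by omega, pow_add z]
    ring
  · rw [show k - ((l : ℕ) + 1) = 0 by omega]
    simp [rhs_eq_zero_of_le_one lam (v_zero lam) zero_le_one, v_zero]

/-- The denominator in the equation of the orbits. -/
def denom (t : ℝ) (z : ℂ) : ℂ :=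
  -1 + (Real.sin t : ℂ) * (Real.cos t : ℂ) * p lam (z * (Real.cos t : ℂ))

/-- The right-hand side of the equation of the orbits. -/
def field (t : ℝ) (z : ℂ) : ℂ :=
  z * p lam (z * (Real.cos t : ℂ)) * (Real.sin t : ℂ) ^ 2 / denom lam t z

lemma norm_cos_le (t : ℝ) : ‖(Real.cos t : ℂ)‖ ≤ 1 := by
  rw [Complex.norm_real]; exact Real.abs_cos_le_one t

lemma norm_sin_le (t : ℝ) : ‖(Real.sin t : ℂ)‖ ≤ 1 := by
  rw [Complex.norm_real]; exact Real.abs_sin_le_one t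

lemma norm_mul_cos_le (t : ℝ) (z : ℂ) : ‖z * (Real.cos t : ℂ)‖ ≤ ‖z‖ := by
  rw [norm_mul]; exact mul_le_of_le_one_right (norm_nonneg _) (norm_cos_le t)

lemma contDiff_p : ContDiff ℝ 1 (p lam) := by
  unfold p
  fun_prop

lemma norm_p_le {z : ℂ} (hz : ‖z‖ ≤ 1) : ‖p lam z‖ ≤ parNorm lam * ‖z‖ := by
  unfold p parNorm
  refine (norm_sum_le _ _).trans ?_
  rw [Finset.sum_mul]
  refine Finset.sum_le_sum fun l _ => ?_
  rw [norm_mul, norm_pow, pow_succ]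
  exact mul_le_mul_of_nonneg_left (mul_le_of_le_one_left (norm_nonneg _)
    (pow_le_one₀ (norm_nonneg _) hz)) (norm_nonneg _)

lemma norm_p_mul_cos_le {a : ℝ} (ha : a ≤ 1) {z : ℂ} (hz : ‖z‖ ≤ a) (t : ℝ) :
    ‖p lam (z * (Real.cos t : ℂ))‖ ≤ parNorm lam * a := by
  have h1 := (norm_mul_cos_le t z).trans hz
  exact (norm_p_le lam (h1.trans ha)).trans
    (mul_le_mul_of_nonneg_left h1 (parNorm_nonneg lam))

lemma le_norm_denom {a : ℝ} (ha : a ≤ 1) (ha2 : parNorm lam * a ≤ 1 / 2) {z : ℂ}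
    (hz : ‖z‖ ≤ a) (t : ℝ) : 1 / 2 ≤ ‖denom lam t z‖ := by
  have h1 := norm_p_mul_cos_le lam ha hz t
  have h2 : ‖(Real.sin t : ℂ) * (Real.cos t : ℂ) * p lam (z * (Real.cos t : ℂ))‖ ≤ 1 / 2 := by
    rw [norm_mul, norm_mul]
    calc _ ≤ 1 * 1 * (parNorm lam * a) := by
          gcongr
          · exact norm_sin_le t
          · exact norm_cos_le t
      _ ≤ 1 / 2 := by linarith
  have h3 := norm_sub_norm_le (1 : ℂ)
    ((Real.sin t : ℂ) * (Real.cos t : ℂ) * p lam (z * (Real.cos t : ℂ)))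
  rw [norm_one] at h3
  have h4 : denom lam t z =
      -(1 - (Real.sin t : ℂ) * (Real.cos t : ℂ) * p lam (z * (Real.cos t : ℂ))) := by
    unfold denom; ring
  rw [h4, norm_neg]
  linarith

/-- The set need not be convex, so no bound on the derivative of the quotient is used: `p` is
Lipschitz on the convex disc, and the two quotients are compared directly. -/
lemma exists_lipschitzOnWith_field (M : ℝ) {ε : ℝ} (hε : 0 < ε) :
    ∃ K : NNReal, ∀ t, LipschitzOnWith K (field lam t) {z | ‖z‖ ≤ M ∧ ε ≤ ‖denom lam t z‖} := by
  obtain ⟨C, hC⟩ := (contDiff_p lam).contDiffOn.exists_lipschitzOnWith one_ne_zero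
    (convex_closedBall (0 : ℂ) M) (isCompact_closedBall (0 : ℂ) M)
  obtain ⟨B, hB⟩ := (isCompact_closedBall (0 : ℂ) M).exists_bound_of_continuousOn
    (contDiff_p lam).continuous.continuousOn
  rcases lt_or_ge M 0 with hM | hM
  · exact ⟨0, fun t x hx => absurd ((norm_nonneg x).trans hx.1) (not_le.2 hM)⟩
  have hB0 : 0 ≤ B := (norm_nonneg _).trans (hB 0 (by simpa using hM))
  refine ⟨Real.toNNReal ((B + M * C) / ε + M * B * C / (ε * ε)), fun t => ?_⟩
  refine LipschitzOnWith.of_dist_le_mul fun x hx y hy => ?_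
  rw [Real.coe_toNNReal _ (by positivity), dist_eq_norm, dist_eq_norm]
  have hmem : ∀ x : ℂ, ‖x‖ ≤ M → x * (Real.cos t : ℂ) ∈ Metric.closedBall (0 : ℂ) M := fun x hx =>
    mem_closedBall_zero_iff.2 ((norm_mul_cos_le t x).trans hx)
  have hp : ‖p lam (x * (Real.cos t : ℂ)) - p lam (y * (Real.cos t : ℂ))‖ ≤ C * ‖x - y‖ := by
    have h1 := hC.dist_le_mul _ (hmem x hx.1) _ (hmem y hy.1)
    rw [dist_eq_norm, dist_eq_norm, ← sub_mul] at h1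
    exact h1.trans (mul_le_mul_of_nonneg_left (norm_mul_cos_le t _) C.2)
  have hs := norm_sin_le t
  have hs2 : ‖(Real.sin t : ℂ)‖ ^ 2 ≤ 1 := pow_le_one₀ (norm_nonneg _) hs
  have hc := norm_cos_le t
  have hDx : denom lam t x ≠ 0 := norm_pos_iff.1 (hε.trans_le hx.2)
  have hDy : denom lam t y ≠ 0 := norm_pos_iff.1 (hε.trans_le hy.2)
  have hN : ‖(x - y) * p lam (x * (Real.cos t : ℂ)) * (Real.sin t : ℂ) ^ 2 +
      y * (p lam (x * (Real.cos t : ℂ)) - p lam (y * (Real.cos t : ℂ))) * (Real.sin t : ℂ) ^ 2‖ ≤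
      (B + M * C) * ‖x - y‖ := by
    refine (norm_add_le _ _).trans ?_
    simp only [norm_mul, norm_pow]
    have h1 : ‖x - y‖ * ‖p lam (x * (Real.cos t : ℂ))‖ * ‖(Real.sin t : ℂ)‖ ^ 2 ≤
        ‖x - y‖ * B * 1 := by
      gcongr
      exact hB _ (hmem x hx.1)
    have h2 : ‖y‖ * ‖p lam (x * (Real.cos t : ℂ)) - p lam (y * (Real.cos t : ℂ))‖ *
        ‖(Real.sin t : ℂ)‖ ^ 2 ≤ M * (C * ‖x - y‖) * 1 := by
      gcongr
      exact hy.1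
    linarith
  have hD : ‖denom lam t y - denom lam t x‖ ≤ C * ‖x - y‖ := by
    have e : denom lam t y - denom lam t x = (Real.sin t : ℂ) * (Real.cos t : ℂ) *
        -(p lam (x * (Real.cos t : ℂ)) - p lam (y * (Real.cos t : ℂ))) := by unfold denom; ring
    rw [e, norm_mul, norm_mul, norm_neg]
    calc _ ≤ 1 * 1 * (C * ‖x - y‖) := by gcongr
      _ = _ := by ring
  have hN2 : ‖y * p lam (y * (Real.cos t : ℂ)) * (Real.sin t : ℂ) ^ 2‖ ≤ M * B := by
    simp only [norm_mul, norm_pow]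
    calc _ ≤ M * B * 1 := by
          gcongr
          · exact hy.1
          · exact hB _ (hmem y hy.1)
      _ = _ := mul_one _
  have e : field lam t x - field lam t y =
      ((x - y) * p lam (x * (Real.cos t : ℂ)) * (Real.sin t : ℂ) ^ 2 +
      y * (p lam (x * (Real.cos t : ℂ)) - p lam (y * (Real.cos t : ℂ))) * (Real.sin t : ℂ) ^ 2) /
        denom lam t x +
      y * p lam (y * (Real.cos t : ℂ)) * (Real.sin t : ℂ) ^ 2 *
        (denom lam t y - denom lam t x) / (denom lam t x * denom lam t y) := by
    unfold field
    field_simp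
    ring
  rw [e]
  refine (norm_add_le _ _).trans ?_
  rw [norm_div, norm_div, norm_mul _ (denom lam t y - _), norm_mul (denom lam t x)]
  calc _ ≤ (B + M * C) * ‖x - y‖ / ε + M * B * (C * ‖x - y‖) / (ε * ε) := by
        gcongr
        · exact hx.2
        · exact hx.2
        · exact hy.2
    _ = _ := by ring

variable {lam}

lemma IsPolarOrbit.continuousOn {r : ℝ → ℂ} (hr : IsPolarOrbit lam r) :
    ContinuousOn r (Set.Icc 0 (2 * Real.pi)) := fun t ht => (hr t ht).2.continuousWithinAt

lemma IsPolarOrbit.exists_bounds {r : ℝ → ℂ} (hr : IsPolarOrbit lam r) :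
    ∃ M ε : ℝ, 0 < ε ∧ ∀ t ∈ Set.Icc 0 (2 * Real.pi), ‖r t‖ ≤ M ∧ ε ≤ ‖denom lam t (r t)‖ := by
  have hpi := Real.pi_pos
  obtain ⟨M, hM⟩ := isCompact_Icc.exists_bound_of_continuousOn hr.continuousOn
  have hcos : Continuous fun t : ℝ => (Real.cos t : ℂ) := by fun_prop
  have hsin : Continuous fun t : ℝ => (Real.sin t : ℂ) := by fun_prop
  have hc : ContinuousOn (fun t => ‖denom lam t (r t)‖) (Set.Icc 0 (2 * Real.pi)) := by
    unfold denom
    exact (continuousOn_const.add ((hsin.mul hcos).continuousOn.mul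
      ((contDiff_p lam).continuous.comp_continuousOn
        (hr.continuousOn.mul hcos.continuousOn)))).norm
  obtain ⟨t0, ht0, hmin⟩ := isCompact_Icc.exists_isMinOn
    (Set.nonempty_Icc.2 (by positivity : (0 : ℝ) ≤ 2 * Real.pi)) hc
  exact ⟨M, _, norm_pos_iff.2 (hr t0 ht0).1, fun t ht => ⟨hM t ht, hmin ht⟩⟩

/-- The competing orbit is not assumed small. Compactness bounds it and keeps its denominator away
from 0, which is enough for uniqueness backwards from 2π. -/
lemma IsPolarOrbit.eqOn {r s : ℝ → ℂ} (hr : IsPolarOrbit lam r) (hs : IsPolarOrbit lam s)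
    (h : r (2 * Real.pi) = s (2 * Real.pi)) : Set.EqOn r s (Set.Icc 0 (2 * Real.pi)) := by
  obtain ⟨M, ε, hε, hb⟩ := hr.exists_bounds
  obtain ⟨M', ε', hε', hb'⟩ := hs.exists_bounds
  obtain ⟨K, hK⟩ := exists_lipschitzOnWith_field lam (max M M') (lt_min hε hε')
  have der : ∀ {r : ℝ → ℂ}, IsPolarOrbit lam r → ∀ t ∈ Set.Ioc 0 (2 * Real.pi),
      HasDerivWithinAt r (field lam t (r t)) (Set.Iic t) t := fun hr t ht =>
    ((hr t ⟨ht.1.le, ht.2⟩).2.mono_of_mem_nhdsWithin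
      (Filter.mem_of_superset (Icc_mem_nhdsLE ht.1) (Set.Icc_subset_Icc_right ht.2)))
  exact ODE_solution_unique_of_mem_Icc_left (fun t _ => hK t) hr.continuousOn (der hr)
    (fun t ht => ⟨(hb t ⟨ht.1.le, ht.2⟩).1.trans (le_max_left _ _),
      (min_le_left _ _).trans (hb t ⟨ht.1.le, ht.2⟩).2⟩) hs.continuousOn (der hs)
    (fun t ht => ⟨(hb' t ⟨ht.1.le, ht.2⟩).1.trans (le_max_right _ _),
      (min_le_right _ _).trans (hb' t ⟨ht.1.le, ht.2⟩).2⟩) h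

lemma hasSum_v_zero_mul_pow (z : ℂ) : HasSum (fun k => v lam k 0 * z ^ k) z := by
  have h := hasSum_ite_eq (1 : ℕ) z
  refine h.congr_fun fun k => ?_
  rw [v_apply_zero]
  split_ifs with h
  · subst h; simp
  · simp

/-- The generating function of the `v_k` is a first integral. -/
lemma IsPolarOrbit.f_eq {r : ℝ → ℂ} (hr : IsPolarOrbit lam r) {a : ℝ} (ha : a ≤ 1)
    (hX : X lam (2 * Real.pi) * a < 1) (ha2 : parNorm lam * a ≤ 1 / 2)
    (hra : ∀ t ∈ Set.Icc 0 (2 * Real.pi), ‖r t‖ ≤ a) : f lam (r (2 * Real.pi)) = r 0 := by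
  have hpi := Real.pi_pos
  have hL := parNorm_nonneg lam
  have ha0 : 0 ≤ a := (norm_nonneg _).trans (hra 0 ⟨le_rfl, by positivity⟩)
  set q := X lam (2 * Real.pi) * a with hq
  have hq0 : 0 ≤ q := mul_nonneg (X_nonneg lam (by positivity)) ha0
  have hbound : ∀ t ∈ Set.Icc 0 (2 * Real.pi), X lam t * ‖r t‖ ≤ q := fun t ht => by
    have : X lam t ≤ X lam (2 * Real.pi) := by
      unfold X
      have := ht.2
      gcongr
    exact mul_le_mul this (hra t ht) (norm_nonneg _) (X_nonneg lam (by positivity))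
  set G : ℝ → ℂ := fun t => ∑' k, v lam k t * r t ^ k with hG
  have hGc : ContinuousOn G (Set.Icc 0 (2 * Real.pi)) := by
    refine continuousOn_tsum (fun k => ?_) (summable_geometric_of_lt_one hq0 hX)
      fun k t ht => norm_v_mul_pow_le lam k ht.1 (hbound t ht)
    exact (contDiff_v lam k).continuous.continuousOn.mul (hr.continuousOn.pow k)
  have hder : ∀ t ∈ Set.Ioo 0 (2 * Real.pi), HasDerivAt G 0 t := by
    -- Writing r' = r w turns the derivative of r^k into k r^k w, without the exponent k-1; moreover
    -- |w| ≤ 1.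
    set w : ℝ → ℂ := fun t => p lam (r t * (Real.cos t : ℂ)) * (Real.sin t : ℂ) ^ 2 /
      denom lam t (r t) with hw
    have hwb : ∀ t ∈ Set.Ioo 0 (2 * Real.pi), ‖w t‖ ≤ 1 := fun t ht => by
      have ht' := Set.Ioo_subset_Icc_self ht
      have h1 := norm_p_mul_cos_le lam ha (hra t ht') t
      have h2 := le_norm_denom lam ha ha2 (hra t ht') t
      rw [hw]
      simp only
      rw [norm_div, div_le_one (by linarith), norm_mul, norm_pow]
      refine (mul_le_of_le_one_right (norm_nonneg _)
        (pow_le_one₀ (norm_nonneg _) (norm_sin_le t))).trans ?_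
      linarith
    have hrd : ∀ t ∈ Set.Ioo 0 (2 * Real.pi), HasDerivAt r (r t * w t) t := fun t ht => by
      refine ((hr t (Set.Ioo_subset_Icc_self ht)).2.hasDerivAt (Icc_mem_nhds ht.1 ht.2)).congr_deriv
        ?_
      simp only [hw, denom]
      ring
    have hsum : Summable fun k : ℕ => 2 * ((k : ℝ) * q ^ k) :=
      (summable_nat_mul_pow hq0 hX).mul_left 2
    intro t ht
    have hmain := hasDerivAt_tsum_of_isPreconnected (g := fun k t => v lam k t * r t ^ k)
      (g' := fun k t => rhs lam (v lam) k t * r t ^ k + (k : ℂ) * (v lam k t * r t ^ k) * w t)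
      hsum isOpen_Ioo isPreconnected_Ioo (fun k t ht => ?_) (fun k t ht => ?_) ht ?_ ht
    · refine hmain.congr_deriv ?_
      have ht' := Set.Ioo_subset_Icc_self ht
      have hz := (hbound t ht').trans_lt hX
      have hs := summable_nat_mul_pow hq0 hX
      have hA : Summable fun k => rhs lam (v lam) k t * r t ^ k :=
        Summable.of_norm_bounded hs fun k => norm_rhs_mul_pow_le lam k ht'.1 (hbound t ht')
      have hB : Summable fun k : ℕ => (k : ℂ) * (v lam k t * r t ^ k) :=
        Summable.of_norm_bounded hs fun k => by
          rw [norm_mul, Complex.norm_natCast]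
          exact mul_le_mul_of_nonneg_left (norm_v_mul_pow_le lam k ht'.1 (hbound t ht'))
            (Nat.cast_nonneg _)
      rw [hA.tsum_add (hB.mul_right _), hB.tsum_mul_right]
      have hpde := tsum_rhs_eq lam ht'.1 hz
      set A := ∑' k, rhs lam (v lam) k t * r t ^ k
      set B := ∑' k : ℕ, (k : ℂ) * (v lam k t * r t ^ k)
      have hD : denom lam t (r t) ≠ 0 := (hr t ht').1
      rw [hw]
      simp only
      -- The derivative of the sum is A + Bw. Multiplied by the denominator, its vanishing is
      -- exactly the partial differential equation.
      rw [mul_div_assoc', ← mul_right_inj' hD, mul_add, mul_div_cancel₀ _ hD, mul_zero, denom]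
      linear_combination (-1) * hpde
    · refine ((hasDerivAt_v lam k t).mul ((hrd t ht).fun_pow k)).congr_deriv ?_
      rcases k with _ | k
      · simp
      · rw [Nat.add_sub_cancel]
        ring
    · have ht' := Set.Ioo_subset_Icc_self ht
      refine (norm_add_le _ _).trans ?_
      have h1 := norm_rhs_mul_pow_le lam k ht'.1 (hbound t ht')
      have h2 := norm_v_mul_pow_le lam k ht'.1 (hbound t ht')
      have h3 : ‖(k : ℂ) * (v lam k t * r t ^ k) * w t‖ ≤ k * q ^ k * 1 := by
        rw [norm_mul, norm_mul _ (v lam k t * r t ^ k), Complex.norm_natCast]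
        gcongr
        exact hwb t ht
      linarith
    · have ht' := Set.Ioo_subset_Icc_self ht
      exact Summable.of_norm_bounded (summable_geometric_of_lt_one hq0 hX)
        fun k => norm_v_mul_pow_le lam k ht'.1 (hbound t ht')
  have hmid : Real.pi ∈ Set.Ioo 0 (2 * Real.pi) := ⟨hpi, by linarith⟩
  have hconst : Set.EqOn G (fun _ => G Real.pi) (Set.Icc 0 (2 * Real.pi)) := by
    refine Set.EqOn.of_subset_closure (s := Set.Ioo 0 (2 * Real.pi)) (fun t ht => ?_) hGc
      continuousOn_const Set.Ioo_subset_Icc_self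
      (by rw [closure_Ioo (by positivity : (0 : ℝ) ≠ 2 * Real.pi)])
    exact isOpen_Ioo.is_const_of_deriv_eq_zero isPreconnected_Ioo
      (fun t ht => (hder t ht).differentiableAt.differentiableWithinAt)
      (fun t ht => (hder t ht).deriv) ht hmid
  have h1 := hconst (Set.left_mem_Icc.2 (by positivity : (0 : ℝ) ≤ 2 * Real.pi))
  have h2 := hconst (Set.right_mem_Icc.2 (by positivity : (0 : ℝ) ≤ 2 * Real.pi))
  have h3 : G 0 = r 0 := (hasSum_v_zero_mul_pow (r 0)).tsum_eq
  rw [← h3, h1, ← h2]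
  rfl

/-- On the disc of radius a, |p| ≤ 1/32 and the denominator is at least 1/2, so the field is at most
a/16. Over a time 2π ≤ 8 the orbit moves by at most a/2, and it starts within a/2. -/
lemma exists_isPolarOrbit {a : ℝ} (ha0 : 0 < a) (ha : a ≤ 1) (ha2 : parNorm lam * a ≤ 1 / 32)
    {x : ℂ} (hx : ‖x‖ ≤ a / 2) : ∃ r, IsPolarOrbit lam r ∧ r (2 * Real.pi) = x ∧
      ∀ t ∈ Set.Icc 0 (2 * Real.pi), ‖r t‖ ≤ a := by
  have hpi := Real.pi_pos
  have hpi4 := Real.pi_le_four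
  obtain ⟨K, hK⟩ := exists_lipschitzOnWith_field lam a (show (0 : ℝ) < 1 / 2 by norm_num)
  have hden : ∀ t (z : ℂ), ‖z‖ ≤ a → 1 / 2 ≤ ‖denom lam t z‖ := fun t z hz =>
    le_norm_denom lam ha (by linarith) hz t
  let t₀ : Set.Icc (0 : ℝ) (2 * Real.pi) := ⟨2 * Real.pi, by positivity, le_rfl⟩
  have hPL : IsPicardLindelof (field lam) t₀ (0 : ℂ) a.toNNReal (a / 2).toNNReal
      (a / 16).toNNReal K := by
    constructor
    · intro t _
      rw [Real.coe_toNNReal _ ha0.le]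
      refine (hK t).mono fun z hz => ?_
      have hz' : ‖z‖ ≤ a := by simpa using hz
      exact ⟨hz', hden t z hz'⟩
    · intro z hz
      rw [Real.coe_toNNReal _ ha0.le] at hz
      have hz' : ‖z‖ ≤ a := by simpa using hz
      have hp := (contDiff_p lam).continuous
      have hne : ∀ t, denom lam t z ≠ 0 := fun t =>
        norm_pos_iff.1 ((by norm_num : (0 : ℝ) < 1 / 2).trans_le (hden t z hz'))
      refine Continuous.continuousOn ?_
      unfold field
      refine Continuous.div (by fun_prop) ?_ hne
      unfold denom
      fun_prop
    · intro t _ z hz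
      rw [Real.coe_toNNReal _ ha0.le] at hz
      rw [Real.coe_toNNReal _ (by positivity)]
      have hz' : ‖z‖ ≤ a := by simpa using hz
      have h1 := norm_p_mul_cos_le lam ha hz' t
      have h2 := hden t z hz'
      rw [field, norm_div, div_le_iff₀ (by linarith), norm_mul, norm_mul, norm_pow]
      calc ‖z‖ * ‖p lam (z * (Real.cos t : ℂ))‖ * ‖(Real.sin t : ℂ)‖ ^ 2
          ≤ a * (1 / 32) * 1 := by
            gcongr
            · exact h1.trans ha2
            · exact pow_le_one₀ (norm_nonneg _) (norm_sin_le t)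
        _ = a / 16 * (1 / 2) := by ring
        _ ≤ _ := by gcongr
    · rw [Real.coe_toNNReal _ ha0.le, Real.coe_toNNReal _ (by positivity),
        Real.coe_toNNReal _ (by positivity)]
      simp only [t₀, sub_self, sub_zero]
      rw [max_eq_right (by positivity)]
      nlinarith
  have hx' : x ∈ Metric.closedBall (0 : ℂ) (a / 2).toNNReal := by
    rw [Real.coe_toNNReal _ (by positivity)]; simpa using hx
  -- The Picard fixed point is used directly, because it also carries the bound |r| ≤ a.
  obtain ⟨α, hα⟩ := ODE.FunSpace.exists_isFixedPt_next hPL hx'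
  have hmem : ∀ t, ‖α.compProj t‖ ≤ a := fun t => by
    have := α.compProj_mem_closedBall hPL.mul_max_le (t := t)
    rw [Real.coe_toNNReal _ ha0.le] at this
    simpa using this
  refine ⟨α.compProj, fun t ht => ⟨?_, ?_⟩, ?_, fun t _ => hmem t⟩
  · exact norm_pos_iff.1 ((by norm_num : (0 : ℝ) < 1 / 2).trans_le (hden t _ (hmem t)))
  · refine HasDerivWithinAt.congr_of_mem (ODE.hasDerivWithinAt_picard_Icc t₀.2
      hPL.continuousOn_uncurry α.continuous_compProj.continuousOn
      (fun _ _ => α.compProj_mem_closedBall hPL.mul_max_le) x ht) (fun t' ht' => ?_) ht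
    nth_rw 1 [← hα]
    rw [ODE.FunSpace.compProj_of_mem ht', ODE.FunSpace.next_apply]
  · have : α.compProj t₀ = x := by
      rw [ODE.FunSpace.compProj_val, ← hα, ODE.FunSpace.next_apply₀]
    exact this

/-- On small discs `f` is the inverse of the return map. -/
lemma inverseReturn_iff {a : ℝ} (ha0 : 0 < a) (ha : a ≤ 1) (ha2 : parNorm lam * a ≤ 1 / 32)
    (hX : X lam (2 * Real.pi) * a < 1) {x : ℂ} (hx : ‖x‖ ≤ a / 2) (y : ℂ) :
    InverseReturn lam x y ↔ y = f lam x := by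
  have hpi := Real.pi_pos
  obtain ⟨r, hr, hrx, hra⟩ := exists_isPolarOrbit ha0 ha ha2 hx
  have hf := hr.f_eq ha hX (by linarith) hra
  rw [hrx] at hf
  constructor
  · rintro ⟨s, hs, hsx, rfl⟩
    rw [hf]
    exact hs.eqOn hr (hsx.trans hrx.symm) ⟨le_rfl, by positivity⟩
  · rintro rfl
    exact ⟨r, hr, hrx, hf.symm⟩

end Orbits

/-! ### The displacement function and its zeros. -/

section Displacement

variable {d n : ℕ}

/-- The index of the coefficient of `x ^ (2 m + 2)`. -/
def evenIdx (hn : n = d / 2) (m : Fin n) : Fin d := ⟨2 * m + 1, by have := m.2; omega⟩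

lemma v_two_pi_eq_sum_even (hn : n = d / 2) (lam : Fin d → ℂ) {k : ℕ} (hk : k ≠ 1) :
    v lam k (2 * Real.pi) = ∑ m : Fin n, lam (evenIdx hn m) *
      W lam (oddPart lam) (evenIdx hn m) k (2 * Real.pi) := by
  rw [v_two_pi_eq_sum lam hk]
  symm
  refine Finset.sum_of_injOn (evenIdx hn) (fun a _ b _ h => ?_) (fun _ _ => by simp)
    (fun l _ hl => ?_) fun m _ => ?_
  · have := congrArg Fin.val h
    simp only [evenIdx] at this
    exact Fin.ext (by omega)
  · rw [sub_oddPart, if_neg, zero_mul]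
    intro h
    refine hl ⟨⟨(l : ℕ) / 2, by have := l.2; omega⟩, by simp, Fin.ext ?_⟩
    simp only [evenIdx]
    omega
  · rw [sub_oddPart, if_pos]
    simp only [evenIdx]
    omega

/-- The displacement function divided by `x ^ 3`. -/
def reduced (lam : Fin d → ℂ) (x : ℂ) : ℂ := ∑' k : ℕ, v lam (k + 3) (2 * Real.pi) * x ^ k

section Series

variable (lam : Fin d → ℂ)

/-- A radius of a disc on which all the series converge. -/
def rho (lam : Fin d → ℂ) : ℝ := 1 / (16 * (1 + parNorm lam))

lemma X_mul_norm_le {x : ℂ} (hx : x ∈ Metric.ball (0 : ℂ) (rho lam)) :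
    X lam (2 * Real.pi) * ‖x‖ ≤ 15 / 16 := by
  have hL := parNorm_nonneg lam
  have hx' : ‖x‖ < rho lam := by simpa using hx
  calc X lam (2 * Real.pi) * ‖x‖ ≤ 15 * (1 + parNorm lam) * rho lam := by
        gcongr
        exact X_two_pi_le lam
    _ = 15 / 16 := by unfold rho; field_simp

lemma norm_term_le {x : ℂ} (hx : x ∈ Metric.ball (0 : ℂ) (rho lam)) (k : ℕ) :
    ‖term lam x k‖ ≤ (15 / 16) ^ k :=
  norm_v_mul_pow_le lam k (by positivity) (X_mul_norm_le lam hx)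

lemma summable_term {x : ℂ} (hx : x ∈ Metric.ball (0 : ℂ) (rho lam)) : Summable (term lam x) :=
  Summable.of_norm_bounded (summable_geometric_of_lt_one (by norm_num) (by norm_num))
    (norm_term_le lam hx)

lemma differentiableOn_f : DifferentiableOn ℂ (f lam) (Metric.ball 0 (rho lam)) :=
  Complex.differentiableOn_tsum_of_summable_norm
    (summable_geometric_of_lt_one (by norm_num : (0 : ℝ) ≤ 15 / 16) (by norm_num))
    (fun k => by unfold term; fun_prop) Metric.isOpen_ball fun k x hx => norm_term_le lam hx k

lemma norm_reduced_term_le {x : ℂ} (hx : x ∈ Metric.ball (0 : ℂ) (rho lam)) (k : ℕ) :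
    ‖v lam (k + 3) (2 * Real.pi) * x ^ k‖ ≤ (15 * (1 + parNorm lam)) ^ 2 * (15 / 16) ^ k := by
  have hX0 : 0 ≤ X lam (2 * Real.pi) := X_nonneg lam (by positivity)
  have h := norm_v_le lam (k + 2) (t := 2 * Real.pi) (by positivity)
  rw [norm_mul, norm_pow]
  calc ‖v lam (k + 3) (2 * Real.pi)‖ * ‖x‖ ^ k ≤ X lam (2 * Real.pi) ^ (k + 2) * ‖x‖ ^ k := by
        gcongr
    _ = X lam (2 * Real.pi) ^ 2 * (X lam (2 * Real.pi) * ‖x‖) ^ k := by rw [mul_pow]; ring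
    _ ≤ _ := by
        have := X_two_pi_le lam
        have := X_mul_norm_le lam hx
        gcongr

lemma summable_reduced_bound : Summable fun k : ℕ =>
    (15 * (1 + parNorm lam)) ^ 2 * (15 / 16 : ℝ) ^ k :=
  (summable_geometric_of_lt_one (by norm_num) (by norm_num)).mul_left _

lemma differentiableOn_reduced : DifferentiableOn ℂ (reduced lam) (Metric.ball 0 (rho lam)) :=
  Complex.differentiableOn_tsum_of_summable_norm (summable_reduced_bound lam)
    (fun k => by fun_prop) Metric.isOpen_ball fun k x hx => norm_reduced_term_le lam hx k

lemma norm_reduced_le {x : ℂ} (hx : x ∈ Metric.ball (0 : ℂ) (rho lam)) :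
    ‖reduced lam x‖ ≤ (15 * (1 + parNorm lam)) ^ 2 * 16 := by
  have h := tsum_of_norm_bounded (summable_reduced_bound lam).hasSum
    (norm_reduced_term_le lam hx)
  rw [tsum_mul_left, tsum_geometric_of_lt_one (by norm_num) (by norm_num)] at h
  norm_num at h ⊢
  exact h

/-- The first even power is x², and its divided difference starts only at order 3. -/
lemma v_two_two_pi : v lam 2 (2 * Real.pi) = 0 := by
  rw [v_two_pi_eq_sum lam (by norm_num)]
  refine Finset.sum_eq_zero fun l _ => ?_
  rw [sub_oddPart]
  split_ifs with h
  · rw [W_eq_zero lam _ l (by omega)]; simp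
  · simp

lemma f_eq {x : ℂ} (hx : x ∈ Metric.ball (0 : ℂ) (rho lam)) :
    f lam x = x + x ^ 3 * reduced lam x := by
  have h := (summable_term lam hx).sum_add_tsum_nat_add 3
  unfold f
  rw [← h, reduced, ← tsum_mul_left]
  simp only [Finset.sum_range_succ, Finset.sum_range_zero, term, v_zero, v_one, v_two_two_pi]
  simp only [Pi.zero_apply, zero_mul, add_zero, zero_add, pow_one, one_mul]
  congr 1
  refine tsum_congr fun k => ?_
  ring

end Series

section Dominance

variable (lam : Fin d → ℂ)

/-- The part of the series proportional to the parameter `lam l`. -/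
lemma exists_hasSum_W (hn1 : 1 ≤ n) (hn : n = d / 2) (m : Fin n) {x : ℂ}
    (hx : 80 * n * (1 + parNorm lam) * ‖x‖ < 1) : ∃ Y : ℂ,
    HasSum (fun k : ℕ => W lam (oddPart lam) (evenIdx hn m) (k + 3) (2 * Real.pi) * x ^ k)
      (x ^ (2 * (m : ℕ)) * Y) ∧
    ‖Y‖ ≤ 27 / (1 - 80 * n * (1 + parNorm lam) * ‖x‖) ∧
    ‖Y - c (m + 1)‖ ≤ 27 * (80 * n * (1 + parNorm lam) * ‖x‖) /
      (1 - 80 * n * (1 + parNorm lam) * ‖x‖) := by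
  have hL := parNorm_nonneg lam
  set q := 80 * n * (1 + parNorm lam) * ‖x‖ with hq
  have hq0 : 0 ≤ q := by positivity
  have hl : ((evenIdx hn m : Fin d) : ℕ) = 2 * m + 1 := rfl
  -- The series is restarted at its first nonzero order 2m+3; the leading term is then c (m+1) and
  -- the rest a geometric tail.
  set y : ℕ → ℂ := fun i => W lam (oddPart lam) (evenIdx hn m)
    ((evenIdx hn m : ℕ) + 2 + i) (2 * Real.pi) * x ^ i with hy
  have hyb : ∀ i, ‖y i‖ ≤ 27 * q ^ i := fun i => by
    rw [hy]
    simp only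
    rw [norm_mul, norm_pow, hq, mul_pow, ← mul_assoc]
    gcongr
    exact norm_W_le lam _ hn1 (parNorm_oddPart_le lam) _ (by rw [hl]; have := m.2; omega) i
  have hgeo := (hasSum_geometric_of_lt_one hq0 hx).mul_left 27
  have hys : Summable y := Summable.of_norm_bounded hgeo.summable hyb
  have hy0 : y 0 = c (m + 1) := by
    rw [hy]
    simp only [add_zero, pow_zero, mul_one]
    rw [W_first _ _ _ (by rw [hl]; omega), hl]
    congr 2
    omega
  refine ⟨∑' i, y i, ?_, ?_, ?_⟩
  · rw [← hasSum_nat_add_iff' (2 * (m : ℕ))]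
    have h0 : ∑ i ∈ Finset.range (2 * (m : ℕ)),
        W lam (oddPart lam) (evenIdx hn m) (i + 3) (2 * Real.pi) * x ^ i = 0 :=
      Finset.sum_eq_zero fun i hi => by
        have := Finset.mem_range.1 hi
        rw [W_eq_zero lam _ _ (by rw [hl]; omega)]
        simp
    rw [h0, sub_zero]
    refine (hys.hasSum.mul_left (x ^ (2 * (m : ℕ)))).congr_fun fun k => ?_
    rw [hy]
    simp only [hl]
    rw [show k + 2 * (m : ℕ) + 3 = 2 * m + 1 + 2 + k by omega, pow_add]
    ring
  · rw [div_eq_mul_inv]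
    exact tsum_of_norm_bounded hgeo hyb
  · rw [← hys.sum_add_tsum_nat_add 1, Finset.sum_range_one, hy0, add_sub_cancel_left,
      div_eq_mul_inv]
    have h := tsum_of_norm_bounded (hgeo.mul_left q) fun i => (hyb (i + 1)).trans_eq
      (show 27 * q ^ (i + 1) = q * (27 * q ^ i) by ring)
    refine h.trans_eq ?_
    ring

end Dominance

section Radius

variable (lam : Fin d → ℂ)

lemma radius_pos (hn1 : 1 ≤ n) : 0 < radius n lam := by
  have := parNorm_nonneg lam
  have := c_pos n
  have hn' : (0 : ℝ) < n := by exact_mod_cast hn1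
  unfold radius
  positivity

/-- With δ = c_n/256, the largest circle needed has radius R'/δ^(n-1). The factor c_n^n / 2^(10n-1)
pays for δ^(-(n-1)) and leaves one power of c_n; the last constant is 80/(2^9 π²) ≤ 1/62. -/
lemma radius_div_le (hn1 : 1 ≤ n) {j : ℕ} (hj : j < n) :
    80 * n * (1 + parNorm lam) * (radius n lam / (c n / 256) ^ j) ≤ c n / 62 := by
  have hL := parNorm_nonneg lam
  have hc := c_pos n
  have hc4 := c_le_four n
  have hpi := Real.pi_gt_d2
  have hn' : (0 : ℝ) < n := by exact_mod_cast hn1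
  have hR := radius_pos lam hn1
  obtain ⟨m, hm⟩ : ∃ m, n = m + 1 := ⟨n - 1, by omega⟩
  have h1 : radius n lam / (c n / 256) ^ j ≤ radius n lam / (c n / 256) ^ m := by
    gcongr radius n lam / ?_
    exact pow_le_pow_of_le_one (by positivity) (by linarith) (by omega)
  have h2 : 80 * n * (1 + parNorm lam) * (radius n lam / (c n / 256) ^ m) =
      c n * (80 / (2 ^ 9 * Real.pi ^ 2 * (4 ^ m * (1 + parNorm lam) ^ (4 * m + 4)))) := by
    unfold radius
    rw [show 10 * n - 1 = 8 * m + 2 * m + 9 by omega, show 4 * n + 1 = 4 * m + 4 + 1 by omega,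
      pow_add, pow_add, pow_mul, pow_mul, pow_succ (1 + parNorm lam)]
    have : c n ^ n = c n ^ m * c n := by rw [← pow_succ, ← hm]
    rw [this, div_pow]
    norm_num
    field_simp
  have h3 : (1 : ℝ) ≤ 4 ^ m * (1 + parNorm lam) ^ (4 * m + 4) :=
    one_le_mul_of_one_le_of_one_le (one_le_pow₀ (by norm_num)) (one_le_pow₀ (by linarith))
  have h4 : 80 / (2 ^ 9 * Real.pi ^ 2 * (4 ^ m * (1 + parNorm lam) ^ (4 * m + 4))) ≤ 1 / 62 := by
    rw [div_le_div_iff₀ (by positivity) (by norm_num)]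
    have : (9.8 : ℝ) ≤ Real.pi ^ 2 := by nlinarith
    nlinarith [mul_le_mul_of_nonneg_left h3 (by positivity : 0 ≤ Real.pi ^ 2)]
  calc _ ≤ 80 * n * (1 + parNorm lam) * (radius n lam / (c n / 256) ^ m) := by gcongr
    _ = _ := h2
    _ ≤ c n * (1 / 62) := by gcongr
    _ = _ := by ring

lemma mul_le_of_radius_le (hn1 : 1 ≤ n) {r : ℝ} (hr0 : 0 ≤ r)
    (hr : 80 * n * (1 + parNorm lam) * r ≤ c n / 62) : (1 + parNorm lam) * r ≤ 1 / 1024 := by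
  have hL := parNorm_nonneg lam
  have hc4 := c_le_four n
  have hn' : (1 : ℝ) ≤ n := by exact_mod_cast hn1
  have h0 : 0 ≤ (1 + parNorm lam) * r := by positivity
  nlinarith

lemma radius_small (hn1 : 1 ≤ n) : (1 + parNorm lam) * radius n lam ≤ 1 / 1024 :=
  mul_le_of_radius_le lam hn1 (radius_pos lam hn1).le
    (by simpa using radius_div_le lam hn1 (j := 0) (by omega))

lemma lt_rho {r : ℝ} (hr : (1 + parNorm lam) * r ≤ 1 / 1024) : r < rho lam := by
  have hL := parNorm_nonneg lam
  unfold rho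
  rw [lt_div_iff₀ (by positivity)]
  linarith

end Radius

/-- The zeros of the reduced displacement function. -/
lemma sum_order_reduced_le (hn1 : 1 ≤ n) (hn : n = d / 2) (lam : Fin d → ℂ)
    (hlam : ∃ m : Fin n, lam (evenIdx hn m) ≠ 0) (T : Finset ℂ)
    (hT : (T : Set ℂ) ⊆ Metric.ball 0 (radius n lam)) :
    ∑ z ∈ T, analyticOrderAt (reduced lam) z ≤ ((2 * (n - 1) : ℕ) : ℕ∞) := by
  have hL := parNorm_nonneg lam
  have hc := c_pos n
  have hc4 := c_le_four n
  have hR := radius_pos lam hn1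
  set δ := c n / 256 with hδ
  have hδ0 : 0 < δ := by positivity
  have hδ1 : δ ≤ 1 / 64 := by rw [hδ]; linarith
  obtain ⟨m0, hm0⟩ := hlam
  -- Applied to the variable t = r², since only even powers r^(2i) appear; the circle obtained has
  -- radius R'/δ^j ≥ R'.
  obtain ⟨m, j, hj, hm, hdom⟩ := exists_dominant (fun m : Fin n => ‖lam (evenIdx hn m)‖)
    (fun _ => norm_nonneg _) ⟨m0, norm_pos_iff.2 hm0⟩ hδ0 (hδ1.trans_lt (by norm_num))
    (by positivity : 0 < radius n lam ^ 2)
  set r := radius n lam / δ ^ j with hr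
  have hr0 : 0 < r := by positivity
  have hrR : radius n lam ≤ r := by
    rw [hr, le_div_iff₀ (by positivity)]
    exact mul_le_of_le_one_right hR.le (pow_le_one₀ hδ0.le (by linarith))
  have hKr : 80 * n * (1 + parNorm lam) * r ≤ c n / 62 := radius_div_le lam hn1 hj
  have hrρ : r < rho lam := lt_rho lam (mul_le_of_radius_le lam hn1 hr0.le hKr)
  have ht : radius n lam ^ 2 / δ ^ (2 * j) = r ^ 2 := by
    rw [hr, div_pow (radius n lam), ← pow_mul, mul_comm j]
  simp only [ht, ← pow_mul] at hdom
  refine (sum_analyticOrderAt_le hr0 hrρ (differentiableOn_reduced lam)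
    (a := lam (evenIdx hn m) * c (m + 1)) (m := 2 * m) (fun z hz => ?_) T
    (hT.trans (Metric.ball_subset_ball hrR))).trans ?_
  swap
  · exact_mod_cast (by have := m.2; omega : 2 * (m : ℕ) ≤ 2 * (n - 1))
  have hq : 80 * n * (1 + parNorm lam) * ‖z‖ < 1 := by rw [hz]; linarith
  choose Y hY hY1 hY2 using fun i : Fin n => exists_hasSum_W lam hn1 hn i hq
  rw [hz] at hY1 hY2
  set q := 80 * n * (1 + parNorm lam) * r with hqdef
  have hsum : reduced lam z = ∑ i : Fin n, lam (evenIdx hn i) * (z ^ (2 * (i : ℕ)) * Y i) := by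
    refine HasSum.tsum_eq ((hasSum_sum (s := Finset.univ) fun (i : Fin n) _ =>
      (hY i).mul_left (lam (evenIdx hn i))).congr_fun fun k => ?_)
    rw [v_two_pi_eq_sum_even hn lam (by omega), Finset.sum_mul]
    exact Finset.sum_congr rfl fun i _ => by ring
  have hsplit : reduced lam z - lam (evenIdx hn m) * c (m + 1) * z ^ (2 * (m : ℕ)) =
      lam (evenIdx hn m) * z ^ (2 * (m : ℕ)) * (Y m - c (m + 1)) +
      ∑ i ∈ Finset.univ.erase m, lam (evenIdx hn i) * z ^ (2 * (i : ℕ)) * Y i := by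
    rw [hsum, ← Finset.add_sum_erase _ _ (Finset.mem_univ m)]
    simp only [← mul_assoc]
    ring
  set E := ‖lam (evenIdx hn m)‖ * r ^ (2 * (m : ℕ)) with hE
  have hE0 : 0 < E := by positivity
  have hq1 : 0 < 1 - q := by linarith
  have hrest : ‖∑ i ∈ Finset.univ.erase m, lam (evenIdx hn i) * z ^ (2 * (i : ℕ)) * Y i‖ ≤
      2 * (δ / (1 - δ)) * (E * (27 / (1 - q))) := by
    refine (norm_sum_le _ _).trans ((Finset.sum_le_sum fun i _ => ?_).trans
      (le_of_eq_of_le (Finset.sum_mul _ _ _).symm (mul_le_mul_of_nonneg_right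
        (sum_pow_dist_le m hδ0.le (by linarith)) (by positivity))))
    rw [norm_mul, norm_mul, norm_pow, hz, ← mul_assoc]
    exact mul_le_mul (hdom i) (hY1 i) (norm_nonneg _) (by positivity)
  have hfirst : ‖lam (evenIdx hn m) * z ^ (2 * (m : ℕ)) * (Y m - c (m + 1))‖ ≤
      E * (27 * q / (1 - q)) := by
    rw [norm_mul, norm_mul, norm_pow, hz]
    exact mul_le_mul_of_nonneg_left (hY2 m) hE0.le
  have hmain : ‖lam (evenIdx hn m) * c (m + 1) * z ^ (2 * (m : ℕ))‖ = E * c (m + 1) := by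
    rw [norm_mul, norm_mul, norm_pow, hz, Complex.norm_real, Real.norm_of_nonneg (c_pos _).le]
    ring
  rw [hsplit, hmain]
  refine (norm_add_le _ _).trans_lt ((add_le_add hfirst hrest).trans_lt ?_)
  -- The smallest of the leading constants, c_n, serves for every `m`. With q ≤ c_n/62 and c_n ≤ 4,
  -- the errors amount to (27/62 + 54/252) c_n/(1-q) < c_n.
  have hcm : c n ≤ c (m + 1) := c_anti m.2
  have hδ2 : δ / (1 - δ) ≤ c n / 252 := by
    rw [div_le_div_iff₀ (by linarith) (by norm_num), hδ]
    nlinarith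
  have hfin : 27 * q / (1 - q) + 2 * (c n / 252) * (27 / (1 - q)) < c n := by
    rw [mul_div_assoc', ← add_div, div_lt_iff₀ hq1]
    nlinarith
  calc E * (27 * q / (1 - q)) + 2 * (δ / (1 - δ)) * (E * (27 / (1 - q)))
      ≤ E * (27 * q / (1 - q)) + 2 * (c n / 252) * (E * (27 / (1 - q))) := by gcongr
    _ = E * (27 * q / (1 - q) + 2 * (c n / 252) * (27 / (1 - q))) := by ring
    _ < E * c n := by gcongr
    _ ≤ E * c (m + 1) := by gcongr

lemma analyticOrderAt_sub_id (lam : Fin d → ℂ) {x : ℂ}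
    (hx : x ∈ Metric.ball (0 : ℂ) (rho lam)) :
    analyticOrderAt (fun x => f lam x - x) x =
      (if x = 0 then 3 else 0) + analyticOrderAt (reduced lam) x := by
  have h1 : (fun x => f lam x - x) =ᶠ[nhds x] (fun x => x ^ 3) * reduced lam := by
    filter_upwards [Metric.isOpen_ball.mem_nhds hx] with y hy
    rw [f_eq lam hy, Pi.mul_apply, add_sub_cancel_left]
  have h2 : AnalyticAt ℂ (fun x : ℂ => x ^ 3) x := by fun_prop
  rw [analyticOrderAt_congr h1, analyticOrderAt_mul h2
    ((differentiableOn_reduced lam).analyticAt (Metric.isOpen_ball.mem_nhds hx))]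
  congr 1
  split_ifs with h
  · subst h
    exact (h2.analyticOrderAt_eq_natCast (n := 3)).2 ⟨fun _ => 1, analyticAt_const, one_ne_zero,
      Filter.Eventually.of_forall fun z => by simp⟩
  · exact h2.analyticOrderAt_eq_zero.2 (pow_ne_zero _ h)

lemma zeroCount_le {g : ℂ → ℂ} {s : Set ℂ} {N : ℕ∞}
    (h : ∀ T : Finset ℂ, (T : Set ℂ) ⊆ s → ∑ x ∈ T, analyticOrderAt g x ≤ N) :
    zeroCount g s ≤ N := iSup₂_le h

end Displacement

end Lienard

end

/-! ### Assembly of the theorem. -/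

theorem mainTheorem2 (d n : ℕ) (hd : 2 ≤ d) (hn : n = d / 2) (lam : Fin d → ℂ) :
    Lienard.bautinIndex d = 2 * n + 1 ∧
    -- the series converges in the disc, and its sum is analytic there
    (∀ x ∈ Metric.ball (0 : ℂ) (Lienard.radius n lam), Summable (Lienard.term lam x)) ∧
    AnalyticOnNhd ℂ (Lienard.f lam) (Metric.ball (0 : ℂ) (Lienard.radius n lam)) ∧
    -- its sum is the inverse of the first return map
    (∀ x ∈ Metric.ball (0 : ℂ) (Lienard.radius n lam), ∀ y : ℂ,
      Lienard.InverseReturn lam x y ↔ y = Lienard.f lam x) ∧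
    -- zeros of `f_λ` itself
    Lienard.zeroCount (Lienard.f lam) (Metric.ball (0 : ℂ) (Lienard.radius n lam)) <
      ((2 * n : ℕ) : ℕ∞) ∧
    -- zeros of `f_λ(x) - x`, that is, complex limit cycles
    ((∃ x ∈ Metric.ball (0 : ℂ) (Lienard.radius n lam), Lienard.f lam x ≠ x) →
      1 + Lienard.zeroCount (fun x => Lienard.f lam x - x)
          (Metric.ball (0 : ℂ) (Lienard.radius n lam) \ {0}) < ((2 * n : ℕ) : ℕ∞) ∧
      Lienard.zeroCount (fun x => Lienard.f lam x - x)
          (Metric.ball (0 : ℂ) (Lienard.radius n lam)) ≤ ((2 * n + 1 : ℕ) : ℕ∞)) := by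
  open Lienard in
  have hn1 : 1 ≤ n := by omega
  have hL := parNorm_nonneg lam
  have hR := radius_pos lam hn1
  have hRs := radius_small lam hn1
  have hRρ := lt_rho lam hRs
  have hsub : Metric.ball (0 : ℂ) (radius n lam) ⊆ Metric.ball 0 (rho lam) :=
    Metric.ball_subset_ball hRρ.le
  refine ⟨bautinIndex_eq hd hn, fun x hx => summable_term lam (hsub hx),
    ((differentiableOn_f lam).analyticOnNhd Metric.isOpen_ball).mono hsub, fun x hx y => ?_, ?_,
    fun hne => ?_⟩
  · have hx' : ‖x‖ < radius n lam := by simpa using hx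
    have hX := X_two_pi_le lam
    -- Orbits ending in the disc of radius R' stay in the disc of radius 2R'.
    refine inverseReturn_iff (a := 2 * radius n lam) (by positivity) ?_ ?_ ?_ (by linarith) y
    · nlinarith
    · nlinarith
    · nlinarith
  -- On |x| = R' the term x dominates f(x) - x = x³ · reduced, so f has at most one zero, and 1 <
  -- 2n.
  · refine lt_of_le_of_lt (zeroCount_le (N := ((1 : ℕ) : ℕ∞)) fun T hT =>
      sum_analyticOrderAt_le hR hRρ (differentiableOn_f lam) (a := 1) (m := 1) (fun z hz => ?_) T
        hT) (by exact_mod_cast (by omega : 1 < 2 * n))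
    have hzρ : z ∈ Metric.ball (0 : ℂ) (rho lam) := by simpa [hz] using hRρ
    have hb := norm_reduced_le lam hzρ
    rw [f_eq lam hzρ, one_mul, pow_one, add_sub_cancel_left, norm_mul, norm_pow, hz]
    have h1 : radius n lam ^ 3 * ‖reduced lam z‖ ≤
        radius n lam ^ 3 * ((15 * (1 + parNorm lam)) ^ 2 * 16) := by gcongr
    have h2 : radius n lam ^ 3 * ((15 * (1 + parNorm lam)) ^ 2 * 16) =
        radius n lam * (3600 * ((1 + parNorm lam) * radius n lam) ^ 2) := by ring
    have h3 : ((1 + parNorm lam) * radius n lam) ^ 2 ≤ (1 / 1024) ^ 2 := by gcongr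
    nlinarith
  -- If all even coefficients vanished, f would be the identity.
  · have hlam : ∃ m : Fin n, lam (evenIdx hn m) ≠ 0 := by
      by_contra! h0
      obtain ⟨x, hx, hfx⟩ := hne
      refine hfx ?_
      rw [f_eq lam (hsub hx), reduced]
      simp [v_two_pi_eq_sum_even hn lam, h0]
    have key := sum_order_reduced_le hn1 hn lam hlam
    constructor
    · have h : zeroCount (fun x => f lam x - x) (Metric.ball (0 : ℂ) (radius n lam) \ {0}) ≤
          ((2 * (n - 1) : ℕ) : ℕ∞) := zeroCount_le fun T hT => by
        refine le_of_eq_of_le (Finset.sum_congr rfl fun x hx => ?_)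
          (key T (hT.trans Set.sdiff_subset))
        have := hT hx
        rw [analyticOrderAt_sub_id lam (hsub this.1), if_neg (by simpa using this.2), zero_add]
      calc 1 + zeroCount (fun x => f lam x - x) (Metric.ball (0 : ℂ) (radius n lam) \ {0})
          ≤ 1 + ((2 * (n - 1) : ℕ) : ℕ∞) := by gcongr
        _ < ((2 * n : ℕ) : ℕ∞) := by exact_mod_cast (by omega : 1 + 2 * (n - 1) < 2 * n)
    · refine zeroCount_le fun T hT => ?_
      -- The factor x³ adds 3 at the origin only, hence 3 + 2(n-1) = 2n+1 in total.
      have h : ∑ x ∈ T, analyticOrderAt (fun x => f lam x - x) x =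
          ∑ x ∈ T, (if x = 0 then 3 else 0) + ∑ x ∈ T, analyticOrderAt (reduced lam) x := by
        rw [← Finset.sum_add_distrib]
        exact Finset.sum_congr rfl fun x hx => analyticOrderAt_sub_id lam (hsub (hT hx))
      have h3 : ∑ x ∈ T, (if x = 0 then (3 : ℕ∞) else 0) ≤ 3 := by
        rw [Finset.sum_ite_eq']
        split_ifs <;> simp
      rw [h]
      calc _ ≤ (3 : ℕ∞) + ((2 * (n - 1) : ℕ) : ℕ∞) := add_le_add h3 (key T hT)
        _ ≤ _ := by exact_mod_cast (by omega : 3 + 2 * (n - 1) ≤ 2 * n + 1)
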